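/- **Setting.** Let $n,T,L\ge 1$ be integers and let $w^*_s\in(0,\infty)^n$, $s\in[0,1]$, be weight vectors of $n$ items. Put $\pi^\star(s)=w^*_s/\sum_i w^*_{s,i}$, $b(s)=\max_{i,j}w^*_{s,i}/w^*_{s,j}$ and $y^*_{ij}(s)=w^*_{s,j}/(w^*_{s,i}+w^*_{s,j})$, and let $M\ge 0$ be such that $|y^*_{ij}(s)-y^*_{ij}(s')|\le M|s-s'|$ for all $s,s'\in[0,1]$ and $i\ne j$. Let $\mathcal T=\{k/T: k=0,\dots,T\}$. For $t'\in\mathcal T$ let $G_{t'}\sim\mathcal G(n,p(t'))$ be independent Erdős–Rényi graphs on $[n]$, with $p(t')\in[0,1]$. Given the graphs, for each $t'\in\mathcal T$ and each edge $\{i,j\}$ of $G_{t'}$ there are $L$ comparisons with outcomes $y^{(l)}_{ij}(t')=1-y^{(l)}_{ji}(t')\in\{0,1\}$ and $\mathbb P(y^{(l)}_{ij}(t')=1)=y^*_{ij}(t')$, all independent over $t'$, unordered pairs $\{i,j\}$ and $l$; put $y_{ij}(t')=\frac1L\sum_{l=1}^L y^{(l)}_{ij}(t')$. For $t\in[0,1]$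 and a real $\delta\in[\frac12,T]$ let $\mathcal N_\delta(t)=\{t'\in\mathcal T:|t-t'|\le\delta/T\}$, $\mathcal N_{ij,\delta}(t)=\{t'\in\mathcal N_\delta(t):\{i,j\}\in G_{t'}\}$, $p_\delta(t)=1-\prod_{t'\in\mathcal N_\delta(t)}(1-p(t'))$ and $p_{\delta,sum}(t)=\sum_{t'\in\mathcal N_\delta(t)}p(t')$. With $d_\delta(t)=3np_\delta(t)$, let $\hat P(t)$ be the $n\times n$ matrix with entries, for $i\neq j$, $\hat P_{ij}(t)=\frac{1}{d_\delta(t)|\mathcal N_{ij,\delta}(t)|}\sum_{t'\in\mathcal N_{ij,\delta}(t)}y_{ij}(t')$ if $\mathcal N_{ij,\delta}(t)\ne\emptyset$ and $\hat P_{ij}(t)=0$ otherwise, and $\hat P_{ii}(t)=1-\sum_{k\neq i}\hat P_{ik}(t)$. **Theorem.** There are absolute constants $c_0\ge1$, $c_1>0$, $c_2\ge1$, $\tilde C_1\ge 15$, $\tilde C_2\ge1$ and $K>0$ such that, in every such setting, if $n\ge c_1\log n$, $np_\delta(t)\ge c_0\log n$, $p_{\delta,sum}(t)\ge c_2\log n$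 and $$2\tilde C_1\sqrt{\frac{\log n}{L\,n\,p_\delta(t)\,p_{\delta,sum}(t)}}+16\,\frac{M\delta n}{T}\le\frac{1}{96\,b(t)^{7/2}},$$ then with probability at least $1-Kn^{-10}$ the matrix $\hat P(t)$ is row-stochastic, it has a unique stationary distribution $\hat\pi(t)$ (its leading left eigenvector, normalized to a probability vector), and $$\frac{\|\hat\pi(t)-\pi^\star(t)\|_2}{\|\pi^\star(t)\|_2}\le 1536\,\frac{M\delta n\,b(t)^{7/2}}{T}+64\,\tilde C_2\,b(t)^{9/2}\sqrt{\frac{3}{L\,n\,p_\delta(t)\,p_{\delta,sum}(t)}}.$$ -/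

import Mathlib

open MeasureTheory ProbabilityTheory
open scoped Matrix

namespace DynamicBTL

noncomputable section

/-! ### The dynamic Bradley-Terry-Luce model -/

/-- The time of the `k`-th point of the grid `{k / T | k = 0, …, T}`. -/
def gridTime (T : ℕ) (k : Fin (T + 1)) : ℝ := ((k : ℕ) : ℝ) / (T : ℝ)

/-- `winProb w s i j` is the probability that `j` beats `i` at time `s` when the items have the
weights `w s`. -/
def winProb {n : ℕ} (w : ℝ → Fin n → ℝ) (s : ℝ) (i j : Fin n) : ℝ :=
  w s j / (w s i + w s j)

/-- The largest ratio between two weights at time `t`. -/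
def maxRatio {n : ℕ} (w : ℝ → Fin n → ℝ) (t : ℝ) : ℝ :=
  ⨆ e : Fin n × Fin n, w t e.1 / w t e.2

/-- The normalized weight vector at time `t`. -/
def piStar {n : ℕ} (w : ℝ → Fin n → ℝ) (t : ℝ) : Fin n → ℝ :=
  fun i => w t i / ∑ j, w t j

/-- Lipschitz smoothness, with constant `M`, of the pairwise winning probabilities on `[0, 1]`. -/
def LipschitzOutcomes {n : ℕ} (w : ℝ → Fin n → ℝ) (M : ℝ) : Prop :=
  ∀ s ∈ Set.Icc (0 : ℝ) 1, ∀ s' ∈ Set.Icc (0 : ℝ) 1, ∀ i j : Fin n, i ≠ j →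
    |winProb w s i j - winProb w s' i j| ≤ M * |s - s'|

/-- Random data of the dynamic model on the probability space `(Ω, μ)`: independent comparison
graphs `G k ∼ G(n, p k)`, one for each grid point, and, independently of the graphs, independent
outcomes `Y k i j l` of the `l`-th comparison of `i` with `j` at the `k`-th grid point. The value
`true` means that `j` beats `i`, so that `Y k j i l` is the negation of `Y k i j l`. Only the
outcomes along edges of `G k` enter the estimator. -/
structure IsDynamicBTLData {Ω : Type*} [MeasurableSpace Ω] (μ : Measure Ω) {n T L : ℕ}
    (w : ℝ → Fin n → ℝ) (p : Fin (T + 1) → unitInterval)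
    (G : Fin (T + 1) → Ω → SimpleGraph (Fin n))
    (Y : Fin (T + 1) → Fin n → Fin n → Fin L → Ω → Bool) : Prop where
  measurable_graph : ∀ k, Measurable (G k)
  law_graph : ∀ k, HasLaw (G k) (SimpleGraph.binomialRandom (Fin n) (p k)) μ
  indep_graph : iIndepFun G μ
  measurable_outcome : ∀ k i j l, Measurable (Y k i j l)
  swap_outcome : ∀ k i j l ω, i ≠ j → Y k j i l ω = !(Y k i j l ω)
  law_outcome : ∀ k i j l, i ≠ j →
    μ.real {ω | Y k i j l ω = true} = winProb w (gridTime T k) i j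
  indep_outcome :
    iIndepFun (fun (x : Fin (T + 1) × {e : Fin n × Fin n // e.1 < e.2} × Fin L) =>
      Y x.1 x.2.1.1.1 x.2.1.1.2 x.2.2) μ
  indep_graph_outcome :
    IndepFun (fun ω k => G k ω)
      (fun ω (x : Fin (T + 1) × {e : Fin n × Fin n // e.1 < e.2} × Fin L) =>
        Y x.1 x.2.1.1.1 x.2.1.1.2 x.2.2 ω) μ

/-! ### The neighbourhood of a time, and the union graph -/

/-- Indices of the grid points at distance at most `δ / T` from `t`. -/
def nbhd (T : ℕ) (δ t : ℝ) : Finset (Fin (T + 1)) :=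
  {k | |t - gridTime T k| ≤ δ / T}

/-- `1 - ∏ (1 - p k)` over the neighbourhood of `t`: the edge probability of the union graph. -/
def pUnion {T : ℕ} (p : Fin (T + 1) → unitInterval) (δ t : ℝ) : ℝ :=
  1 - ∏ k ∈ nbhd T δ t, (1 - (p k : ℝ))

/-- The sum of the edge probabilities over the neighbourhood of `t`. -/
def pSum {T : ℕ} (p : Fin (T + 1) → unitInterval) (δ t : ℝ) : ℝ :=
  ∑ k ∈ nbhd T δ t, (p k : ℝ)

/-- The union graph over the neighbourhood of `t`. -/
def unionGraph {n T : ℕ} (g : Fin (T + 1) → SimpleGraph (Fin n)) (δ t : ℝ) :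
    SimpleGraph (Fin n) :=
  ⨆ k ∈ nbhd T δ t, g k

open scoped Classical in
/-- Indices of the grid points in the neighbourhood of `t` at which `i` and `j` are compared. -/
def nbhdPair {n T : ℕ} (g : Fin (T + 1) → SimpleGraph (Fin n)) (δ t : ℝ) (i j : Fin n) :
    Finset (Fin (T + 1)) :=
  {k ∈ nbhd T δ t | (g k).Adj i j}

/-! ### The spectral estimator, as a function of the observed data -/

/-- The proportion of the `L` comparisons of `i` and `j` at the `k`-th grid point won by `j`. -/
def winFreq {n T L : ℕ} (y : Fin (T + 1) → Fin n → Fin n → Fin L → Bool)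
    (k : Fin (T + 1)) (i j : Fin n) : ℝ :=
  (∑ l : Fin L, if y k i j l then (1 : ℝ) else 0) / L

/-- The average of `winFreq` over the grid points in the neighbourhood of `t` at which `i` and `j`
are compared (it is `0` if there are none). -/
def avgWinFreq {n T L : ℕ} (g : Fin (T + 1) → SimpleGraph (Fin n))
    (y : Fin (T + 1) → Fin n → Fin n → Fin L → Bool) (δ t : ℝ) (i j : Fin n) : ℝ :=
  (∑ k ∈ nbhdPair g δ t i j, winFreq y k i j) / ((nbhdPair g δ t i j).card : ℝ)

open scoped Classical in
/-- The empirical transition matrix with normalization `d`. -/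
def transMatrix {n T L : ℕ} (g : Fin (T + 1) → SimpleGraph (Fin n))
    (y : Fin (T + 1) → Fin n → Fin n → Fin L → Bool) (δ t d : ℝ) :
    Matrix (Fin n) (Fin n) ℝ :=
  Matrix.of fun i j =>
    if i = j then 1 - (∑ k ∈ Finset.univ.erase i, avgWinFreq g y δ t i k) / d
    else if (unionGraph g δ t).Adj i j then avgWinFreq g y δ t i j / d
    else 0

/-- `π` is a probability vector with `πᵀ P = πᵀ`. -/
def IsStationary {n : ℕ} (P : Matrix (Fin n) (Fin n) ℝ) (π : Fin n → ℝ) : Prop :=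
  π ∈ stdSimplex ℝ (Fin n) ∧ π ᵥ* P = π

/-- `π` is the leading left eigenvector of the transition matrix `P`, normalized to a probability
vector: `P` is row-stochastic, so that its leading eigenvalue is `1`, and `π` is its stationary
distribution and the only one. -/
def IsLeadingLeftEigenvector {n : ℕ} (P : Matrix (Fin n) (Fin n) ℝ) (π : Fin n → ℝ) : Prop :=
  P ∈ Matrix.rowStochastic ℝ (Fin n) ∧ IsStationary P π ∧ ∀ π', IsStationary P π' → π' = π

/-- The relative error in the Euclidean norm of `x` as an approximation of `z`. -/
def relErr {n : ℕ} (x z : Fin n → ℝ) : ℝ :=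
  ‖WithLp.toLp 2 (x - z)‖ / ‖WithLp.toLp 2 z‖

end

end DynamicBTL

open DynamicBTL

namespace DynamicBTL

/-! Write `flow A x` for the net inflow of mass when `x i` moves along the rates `A i j`. It ignores
the diagonal of `A`, and `x ᵥ* P = x + d⁻¹ • flow A x` for the empirical chain `P`
(`vecMul_transMatrix`), so stationarity means `flow A x = 0`, whatever `d` is. The true rates
`btlRate π` satisfy detailed balance with respect to `π`.

Since `pSum` is at least a large multiple of `log n`, a Chernoff bound shows that all pairs are
compared at `pSum / 4` or more times simultaneously (`measureReal_card_nbhdPair_le`). The union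
graph is then complete, and no spectral analysis of a random graph is needed: the comparison chain
lives on the complete graph, where a Dirichlet form computation gives `l2 E ≤ 2 b ^ 3 / n * l2 (flow
(btlRate π) E)` for vectors `E` of sum zero (`l2_le_mul_l2_flow_btlRate`).

The empirical rates are `btlRate π` plus a bias, at most `M δ / T` in each entry by the Lipschitz
condition, plus noise. If the perturbation is small in operator norm, the gap survives with half its
size (`l2_le_mul_l2_flow_of_close`). Applied to a difference of two stationary vectors it gives
uniqueness; applied to `πhat - π` it bounds the error by `flow A π`, which consists of bias and
noise only (`exists_isLeadingLeftEigenvector_relErr_le`).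

Given the graphs, the noise is a sub-Gaussian matrix with variance proxy `2 / (L * pSum)`
(`isSubgaussianMatrix_noise`). Its flow needs two bounds (`measureReal_flow_bounds`): one on all
vectors, from a net and costing a factor `√(log n)`, which only enters the smallness condition; and
one at the fixed vector `π`, without the logarithm, which gives the rate. As graphs and outcomes are
independent, the estimate for fixed graphs transfers to random ones by conditioning
(`measureReal_le_of_indepFun`). -/

/-! ### Euclidean norm of coordinate vectors -/

/-- The Euclidean norm of a coordinate vector. -/
noncomputable def l2 {ι : Type*} [Fintype ι] (v : ι → ℝ) : ℝ := ‖WithLp.toLp 2 v‖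

section l2

variable {ι : Type*} [Fintype ι]

lemma l2_nonneg (v : ι → ℝ) : 0 ≤ l2 v := norm_nonneg _

lemma l2_sq (v : ι → ℝ) : l2 v ^ 2 = ∑ i, v i ^ 2 := by
  rw [l2, EuclideanSpace.norm_sq_eq]
  simp

lemma l2_add_le (u v : ι → ℝ) : l2 (u + v) ≤ l2 u + l2 v := by
  rw [l2, WithLp.toLp_add]
  exact norm_add_le _ _

lemma l2_neg (u : ι → ℝ) : l2 (-u) = l2 u := by
  rw [l2, WithLp.toLp_neg, norm_neg, l2]

lemma l2_sub_le (u v : ι → ℝ) : l2 (u - v) ≤ l2 u + l2 v := by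
  rw [sub_eq_add_neg, ← l2_neg v]
  exact l2_add_le _ _

lemma l2_smul (c : ℝ) (u : ι → ℝ) : l2 (c • u) = |c| * l2 u := by
  rw [l2, WithLp.toLp_smul, norm_smul, Real.norm_eq_abs, l2]

lemma l2_le_of_sq_le {v : ι → ℝ} {c : ℝ} (hc : 0 ≤ c) (h : ∑ i, v i ^ 2 ≤ c ^ 2) : l2 v ≤ c :=
  le_of_sq_le_sq (by rwa [l2_sq]) hc

lemma l2_eq_zero {v : ι → ℝ} : l2 v = 0 ↔ v = 0 := by
  rw [l2, norm_eq_zero, WithLp.toLp_eq_zero]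

lemma dotProduct_le_l2_mul_l2 (u v : ι → ℝ) : ∑ i, u i * v i ≤ l2 u * l2 v := by
  refine le_of_sq_le_sq ?_ (mul_nonneg (l2_nonneg u) (l2_nonneg v))
  rw [mul_pow, l2_sq, l2_sq]
  exact Finset.sum_mul_sq_le_sq_mul_sq _ _ _

lemma sum_abs_le_sqrt_card_mul_l2 (v : ι → ℝ) : ∑ i, |v i| ≤ √(Fintype.card ι) * l2 v := by
  refine le_of_sq_le_sq ?_ (mul_nonneg (Real.sqrt_nonneg _) (l2_nonneg v))
  rw [mul_pow, l2_sq, Real.sq_sqrt (Nat.cast_nonneg _)]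
  simpa using Finset.sum_mul_sq_le_sq_mul_sq Finset.univ (fun _ : ι => (1 : ℝ)) (fun i => |v i|)

lemma l2_le_of_abs_le {u v : ι → ℝ} (h : ∀ i, |u i| ≤ v i) : l2 u ≤ l2 v := by
  refine l2_le_of_sq_le (l2_nonneg v) ?_
  rw [l2_sq]
  exact Finset.sum_le_sum fun i _ => sq_le_sq' (by linarith [neg_abs_le (u i), h i])
    ((le_abs_self _).trans (h i))

lemma l2_const {c : ℝ} (hc : 0 ≤ c) : l2 (fun _ : ι => c) = √(Fintype.card ι) * c := by
  rw [← Real.sqrt_sq (l2_nonneg _), l2_sq, Finset.sum_const, nsmul_eq_mul, Finset.card_univ,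
    Real.sqrt_mul (Nat.cast_nonneg _), Real.sqrt_sq hc]

lemma l2_abs (v : ι → ℝ) : l2 (fun i => |v i|) = l2 v := by
  rw [← Real.sqrt_sq (l2_nonneg _), ← Real.sqrt_sq (l2_nonneg v), l2_sq, l2_sq]
  simp

end l2

/-! ### Probability flows -/

section flow

variable {ι : Type*} [Fintype ι]

/-- The net flow into each state when mass `x i` moves from `i` to `j` at the rate `A i j`. -/
def flow (A : ι → ι → ℝ) (x : ι → ℝ) (j : ι) : ℝ := ∑ i, (x i * A i j - x j * A j i)

lemma flow_add (A B : ι → ι → ℝ) (x : ι → ℝ) : flow (A + B) x = flow A x + flow B x := by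
  ext j
  simp only [flow, Pi.add_apply, ← Finset.sum_add_distrib]
  exact Finset.sum_congr rfl fun i _ => by ring

lemma flow_sub_left (A B : ι → ι → ℝ) (x : ι → ℝ) : flow (A - B) x = flow A x - flow B x := by
  ext j
  simp only [flow, Pi.sub_apply, ← Finset.sum_sub_distrib]
  exact Finset.sum_congr rfl fun i _ => by ring

lemma flow_sub (A : ι → ι → ℝ) (x y : ι → ℝ) : flow A (x - y) = flow A x - flow A y := by
  ext j
  simp only [flow, Pi.sub_apply, ← Finset.sum_sub_distrib]
  exact Finset.sum_congr rfl fun i _ => by ring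

/-- The transition rates of the Bradley-Terry-Luce model with weights `π`. -/
noncomputable def btlRate (π : ι → ℝ) (i j : ι) : ℝ := π j / (π i + π j)

/-- Detailed balance: `π i * π j / (π i + π j)` is symmetric, so every single term of the flow
cancels. -/
lemma flow_btlRate_self (π : ι → ℝ) : flow (btlRate π) π = 0 := by
  ext j
  refine Finset.sum_eq_zero fun i _ => ?_
  rw [btlRate, btlRate, add_comm (π j)]
  ring

/-- Summation by parts for a reversible chain: exchanging `i` and `j` turns the pairing with `f`
into the Dirichlet form. -/
lemma sum_sub_sq_eq {q : ι → ι → ℝ} (hq : ∀ i j, q i j = q j i) (f : ι → ℝ) :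
    ∑ j, (∑ i, q i j * (f i - f j)) * f j = -(1 / 2) * ∑ i, ∑ j, q i j * (f i - f j) ^ 2 := by
  have h1 : ∑ j, (∑ i, q i j * (f i - f j)) * f j = ∑ i, ∑ j, q i j * (f i - f j) * f j := by
    rw [Finset.sum_comm]
    simp only [Finset.sum_mul]
  have h2 : ∑ i, ∑ j, q i j * (f i - f j) * f j = ∑ i, ∑ j, -(q i j * (f i - f j) * f i) := by
    rw [Finset.sum_comm]
    refine Finset.sum_congr rfl fun i _ => Finset.sum_congr rfl fun j _ => ?_
    rw [hq j i]
    ring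
  have h3 : ∑ i, ∑ j, q i j * (f i - f j) ^ 2 =
      -(∑ i, ∑ j, -(q i j * (f i - f j) * f i)) - ∑ i, ∑ j, q i j * (f i - f j) * f j := by
    simp only [← Finset.sum_sub_distrib, ← Finset.sum_neg_distrib]
    refine Finset.sum_congr rfl fun i _ => Finset.sum_congr rfl fun j _ => ?_
    ring
  rw [h3, ← h2, h1]
  ring

lemma sum_mul_sub_sq_eq (π f : ι → ℝ) :
    ∑ i, ∑ j, π i * π j * (f i - f j) ^ 2 =
      2 * ((∑ i, π i) * ∑ i, π i * f i ^ 2 - (∑ i, π i * f i) ^ 2) := by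
  have h : ∀ i j, π i * π j * (f i - f j) ^ 2 =
      (π i * f i ^ 2) * π j + π i * (π j * f j ^ 2) - 2 * ((π i * f i) * (π j * f j)) :=
    fun i j => by ring
  simp only [h, Finset.sum_sub_distrib, Finset.sum_add_distrib, ← Finset.mul_sum,
    ← Finset.sum_mul]
  ring

lemma le_div_card_of_le_mul {π : ι → ℝ} {b : ℝ} (hsum : ∑ i, π i = 1)
    (hb : ∀ i j, π i ≤ b * π j) (i : ι) : π i ≤ b / Fintype.card ι := by
  have hpos : (0 : ℝ) < Fintype.card ι := by
    exact_mod_cast Fintype.card_pos_iff.2 ⟨i⟩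
  rw [le_div_iff₀ hpos]
  have h := Finset.sum_le_sum fun j (_ : j ∈ Finset.univ) => hb i j
  rw [← Finset.mul_sum, hsum, Finset.sum_const, Finset.card_univ, nsmul_eq_mul] at h
  linarith

/-- Spectral gap of the Bradley-Terry-Luce chain on the complete graph, in the form of an a priori
estimate. -/
lemma l2_le_mul_l2_flow_btlRate {π : ι → ℝ} {b : ℝ} (hπ : ∀ i, 0 < π i) (hsum : ∑ i, π i = 1)
    (hb : ∀ i j, π i ≤ b * π j) {E : ι → ℝ} (hE : ∑ i, E i = 0) :
    l2 E ≤ 2 * b ^ 3 / Fintype.card ι * l2 (flow (btlRate π) E) := by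
  rcases isEmpty_or_nonempty ι with hι | ⟨⟨o⟩⟩
  · simp at hsum
  set N : ℝ := (Fintype.card ι : ℝ)
  have hN : 0 < N := by
    simp only [N]
    exact_mod_cast Fintype.card_pos_iff.2 ⟨o⟩
  have hb0 : 0 < b := by
    by_contra! h
    nlinarith [hb o o, hπ o]
  have hmax : ∀ i, π i ≤ b / N := le_div_card_of_le_mul hsum hb
  set f : ι → ℝ := fun i => E i / π i
  have hEf : ∀ i, E i = π i * f i := fun i => by
    simp only [f]
    field_simp [(hπ i).ne']
  set q : ι → ι → ℝ := fun i j => π i * π j / (π i + π j)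
  have hflow : ∀ j, flow (btlRate π) E j = ∑ i, q i j * (f i - f j) := fun j => by
    refine Finset.sum_congr rfl fun i _ => ?_
    rw [hEf i, hEf j, btlRate, btlRate, add_comm (π j)]
    simp only [q]
    ring
  have hform : ∑ j, flow (btlRate π) E j * f j =
      -(1 / 2) * ∑ i, ∑ j, q i j * (f i - f j) ^ 2 := by
    simp only [hflow]
    exact sum_sub_sq_eq (fun i j => by simp only [q]; rw [mul_comm, add_comm]) f
  -- Comparison with the chain that jumps straight to `π`: its Dirichlet form is twice the variance
  -- of `f`, so its gap is explicit.
  have hq : ∀ i j, N / (2 * b) * (π i * π j) ≤ q i j := fun i j => by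
    simp only [q]
    rw [le_div_iff₀ (add_pos (hπ i) (hπ j))]
    have h1 : π i + π j ≤ 2 * (b / N) := by linarith [hmax i, hmax j]
    have h2 : 0 ≤ N / (2 * b) * (π i * π j) := by
      have := hπ i; have := hπ j; positivity
    calc _ ≤ N / (2 * b) * (π i * π j) * (2 * (b / N)) := by gcongr
      _ = π i * π j := by field_simp
  have hgap : N / b * ∑ i, π i * f i ^ 2 ≤ ∑ i, ∑ j, q i j * (f i - f j) ^ 2 := by
    have h1 : ∑ i, ∑ j, N / (2 * b) * (π i * π j) * (f i - f j) ^ 2 ≤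
        ∑ i, ∑ j, q i j * (f i - f j) ^ 2 :=
      Finset.sum_le_sum fun i _ => Finset.sum_le_sum fun j _ =>
        mul_le_mul_of_nonneg_right (hq i j) (sq_nonneg _)
    have h2 : ∑ i, π i * f i = 0 := by rw [← hE]; exact Finset.sum_congr rfl fun i _ => (hEf i).symm
    have h3 : ∑ i, ∑ j, N / (2 * b) * (π i * π j) * (f i - f j) ^ 2 =
        N / (2 * b) * ∑ i, ∑ j, π i * π j * (f i - f j) ^ 2 := by
      simp only [Finset.mul_sum, mul_assoc]
    rw [h3, sum_mul_sub_sq_eq, hsum, h2] at h1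
    refine le_trans (le_of_eq ?_) h1
    field_simp
    ring
  have hE2 : N / b * l2 E ^ 2 ≤ ∑ i, π i * f i ^ 2 := by
    rw [l2_sq, Finset.mul_sum]
    refine Finset.sum_le_sum fun i _ => ?_
    have h1 : N / b * π i ≤ 1 := by
      have := hmax i
      rw [le_div_iff₀ hN] at this
      rw [div_mul_eq_mul_div, div_le_one hb0]
      linarith
    have h2 : 0 ≤ π i * f i ^ 2 := mul_nonneg (hπ i).le (sq_nonneg _)
    calc N / b * E i ^ 2 = N / b * π i * (π i * f i ^ 2) := by rw [hEf i]; ring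
      _ ≤ 1 * (π i * f i ^ 2) := by gcongr
      _ = _ := one_mul _
  -- Passing between the norm weighted by `π` and the Euclidean one uses both `π i ≤ b / N` and `π i
  -- ≥ 1 / (N b)`; this is why the gap constant carries `b ^ 3`.
  have hpimin : ∀ i, 1 ≤ N * b * π i := fun i => by
    have h := Finset.sum_le_sum fun j (_ : j ∈ Finset.univ) => hb j i
    rw [hsum, Finset.sum_const, Finset.card_univ, nsmul_eq_mul] at h
    linarith
  have hf : l2 f ≤ N * b * l2 E := by
    have h : l2 f ≤ l2 (fun i => N * b * |E i|) := by
      refine l2_le_of_abs_le fun i => ?_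
      rw [hEf i, abs_mul, abs_of_pos (hπ i), ← mul_assoc]
      exact le_mul_of_one_le_left (abs_nonneg _) (hpimin i)
    refine h.trans (le_of_eq ?_)
    have h' : (fun i => N * b * |E i|) = (N * b) • fun i => |E i| := rfl
    rw [h', l2_smul, l2_abs, abs_of_pos (mul_pos hN hb0)]
  have hCS : ∑ i, ∑ j, q i j * (f i - f j) ^ 2 ≤ 2 * (l2 (flow (btlRate π) E) * l2 f) := by
    have h := dotProduct_le_l2_mul_l2 (-(flow (btlRate π) E)) f
    rw [l2_neg] at h
    simp only [Pi.neg_apply, neg_mul, Finset.sum_neg_distrib, hform] at h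
    linarith
  rcases (l2_nonneg E).eq_or_lt with h0 | h0
  · rw [← h0]
    have := l2_nonneg (flow (btlRate π) E)
    positivity
  have hF := l2_nonneg (flow (btlRate π) E)
  have key : N / b * (N / b * l2 E ^ 2) ≤ 2 * (l2 (flow (btlRate π) E) * (N * b * l2 E)) :=
    calc _ ≤ N / b * ∑ i, π i * f i ^ 2 := by gcongr
      _ ≤ _ := hgap
      _ ≤ _ := hCS
      _ ≤ _ := by gcongr
  have h2 : N / b * (N / b) * l2 E ≤ 2 * (l2 (flow (btlRate π) E) * (N * b)) :=
    le_of_mul_le_mul_right (by linarith) h0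
  calc l2 E = b ^ 2 / N ^ 2 * (N / b * (N / b) * l2 E) := by field_simp
    _ ≤ b ^ 2 / N ^ 2 * (2 * (l2 (flow (btlRate π) E) * (N * b))) := by gcongr
    _ = _ := by field_simp

/-- Perturbation bound for the stationary vectors of a chain close to a Bradley-Terry-Luce chain on
the complete graph. -/
lemma l2_le_mul_l2_flow_of_close {π : ι → ℝ} {b N : ℝ} (hπ : ∀ i, 0 < π i)
    (hsum : ∑ i, π i = 1) (hb : ∀ i j, π i ≤ b * π j) {A : ι → ι → ℝ}
    (hN : ∀ x, l2 (flow (A - btlRate π) x) ≤ N * l2 x) (hbN : 4 * b ^ 3 * N ≤ Fintype.card ι)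
    {E : ι → ℝ} (hE : ∑ i, E i = 0) :
    l2 E ≤ 4 * b ^ 3 / Fintype.card ι * l2 (flow A E) := by
  rcases isEmpty_or_nonempty ι with hι | ⟨⟨o⟩⟩
  · simp at hsum
  have hcard : (0 : ℝ) < Fintype.card ι := by
    exact_mod_cast Fintype.card_pos_iff.2 ⟨o⟩
  have hb0 : 0 < b := by
    by_contra! h
    nlinarith [hb o o, hπ o]
  have h1 := l2_le_mul_l2_flow_btlRate hπ hsum hb hE
  have h2 : l2 (flow (btlRate π) E) ≤ l2 (flow A E) + N * l2 E := by
    have h := l2_sub_le (flow A E) (flow (A - btlRate π) E)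
    rw [flow_sub_left, sub_sub_cancel] at h
    rw [← flow_sub_left] at h
    exact h.trans (by gcongr; exact hN E)
  -- `hbN` makes the perturbation cost at most half of `l2 E`; absorbing it on the left doubles the
  -- constant.
  have h3 : 2 * b ^ 3 / Fintype.card ι * (N * l2 E) ≤ 1 / 2 * l2 E := by
    rw [← mul_assoc]
    refine mul_le_mul_of_nonneg_right ?_ (l2_nonneg E)
    rw [div_mul_eq_mul_div, div_le_iff₀ hcard]
    linarith
  have h4 : l2 E ≤ 2 * b ^ 3 / Fintype.card ι * l2 (flow A E) + 1 / 2 * l2 E :=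
    calc l2 E ≤ 2 * b ^ 3 / Fintype.card ι * (l2 (flow A E) + N * l2 E) :=
          h1.trans (by gcongr)
      _ ≤ _ := by rw [mul_add]; gcongr
  calc l2 E ≤ 2 * (2 * b ^ 3 / Fintype.card ι * l2 (flow A E)) := by linarith
    _ = _ := by ring

/-- Used for the bias, whose entries are small but have no cancellation. Inflow and outflow each
contribute `β * card ι * l2 x`. -/
lemma l2_flow_le_of_abs_le {B : ι → ι → ℝ} {β : ℝ} (hB : ∀ i j, |B i j| ≤ β) (x : ι → ℝ) :
    l2 (flow B x) ≤ 2 * β * Fintype.card ι * l2 x := by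
  rcases isEmpty_or_nonempty ι with hι | ⟨⟨o⟩⟩
  · rw [Subsingleton.elim (flow B x) x, Subsingleton.elim x 0]
    simp [l2]
  have hβ : 0 ≤ β := (abs_nonneg _).trans (hB o o)
  set N : ℝ := (Fintype.card ι : ℝ)
  have hN : 0 ≤ N := Nat.cast_nonneg _
  have hsq : √N * √N = N := Real.mul_self_sqrt hN
  have h1 : l2 (flow B x) ≤
      l2 ((fun _ => β * (√N * l2 x)) + (β * N) • fun j => |x j|) := by
    refine l2_le_of_abs_le fun j => ?_
    calc |flow B x j| ≤ ∑ i, |x i * B i j - x j * B j i| := Finset.abs_sum_le_sum_abs _ _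
      _ ≤ ∑ i, (β * |x i| + β * |x j|) := by
          refine Finset.sum_le_sum fun i _ => (abs_sub _ _).trans ?_
          rw [abs_mul, abs_mul, mul_comm β, mul_comm β]
          gcongr <;> exact hB _ _
      _ = β * ∑ i, |x i| + β * N * |x j| := by
          rw [Finset.sum_add_distrib, ← Finset.mul_sum, Finset.sum_const, Finset.card_univ,
            nsmul_eq_mul]
          ring
      _ ≤ β * (√N * l2 x) + β * N * |x j| := by
          gcongr
          exact sum_abs_le_sqrt_card_mul_l2 x
      _ = _ := by simp
  refine h1.trans ((l2_add_le _ _).trans (le_of_eq ?_))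
  rw [l2_smul, l2_abs, l2_const (by have := l2_nonneg x; positivity),
    abs_of_nonneg (mul_nonneg hβ hN)]
  linear_combination (β * l2 x) * hsq

/-- The flow is the vector-matrix product minus the action of the diagonal matrix of row sums. -/
lemma l2_flow_le (X : ι → ι → ℝ) {a c : ℝ}
    (hrow : ∀ j, |∑ i, X j i| ≤ a) {x : ι → ℝ} (hop : l2 (fun j => ∑ i, x i * X i j) ≤ c * l2 x) :
    l2 (flow X x) ≤ (c + a) * l2 x := by
  rcases isEmpty_or_nonempty ι with hι | ⟨⟨o⟩⟩
  · rw [Subsingleton.elim (flow X x) x, Subsingleton.elim x 0]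
    simp [l2]
  have ha : 0 ≤ a := (abs_nonneg _).trans (hrow o)
  have h : flow X x = (fun j => ∑ i, x i * X i j) - fun j => x j * ∑ i, X j i := by
    ext j
    simp only [flow, Pi.sub_apply, Finset.sum_sub_distrib, Finset.mul_sum]
  have h2 : l2 (fun j => x j * ∑ i, X j i) ≤ l2 (a • fun j => |x j|) := by
    refine l2_le_of_abs_le fun j => ?_
    rw [abs_mul, mul_comm]
    exact mul_le_mul_of_nonneg_right (hrow j) (abs_nonneg _)
  rw [l2_smul, l2_abs, abs_of_nonneg ha] at h2
  rw [h, add_mul]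
  exact (l2_sub_le _ _).trans (add_le_add hop h2)

end flow

/-! ### Stationary vectors of stochastic matrices -/

/-- `P - 1` kills the constant vector, so it also has a left null vector `v`. By the triangle
inequality `|v| ≤ |v| P` entrywise, and both sides have the same total mass, so equality holds and
`|v|` can be normalized. -/
lemma exists_isStationary {n : ℕ} (hn : 0 < n) {P : Matrix (Fin n) (Fin n) ℝ}
    (hP : P ∈ Matrix.rowStochastic ℝ (Fin n)) : ∃ π, IsStationary P π := by
  have hdet : (P - 1).det = 0 := by
    refine Matrix.exists_mulVec_eq_zero_iff.1 ⟨1, ?_, ?_⟩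
    · intro h
      simpa using congrFun h ⟨0, hn⟩
    · rw [Matrix.sub_mulVec, Matrix.one_mulVec, Matrix.one_vecMul_of_mem_rowStochastic hP, sub_self]
  obtain ⟨v, hv0, hv⟩ := Matrix.exists_vecMul_eq_zero_iff.2 hdet
  rw [Matrix.vecMul_sub, Matrix.vecMul_one, sub_eq_zero] at hv
  have hP0 : ∀ i j, 0 ≤ P i j := fun i j =>
    Matrix.nonneg_of_mem_rowStochastic hP
  have hle : ∀ j, |v j| ≤ ∑ i, |v i| * P i j := fun j => by
    conv_lhs => rw [← hv]
    change |∑ i, v i * P i j| ≤ _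
    refine (Finset.abs_sum_le_sum_abs _ _).trans (le_of_eq ?_)
    exact Finset.sum_congr rfl fun i _ => by rw [abs_mul, abs_of_nonneg (hP0 i j)]
  have hsum : ∑ j, |v j| = ∑ j, ∑ i, |v i| * P i j := by
    rw [Finset.sum_comm]
    simp only [← Finset.mul_sum, Matrix.sum_row_of_mem_rowStochastic hP, mul_one]
  have heq : ∀ j, |v j| = ∑ i, |v i| * P i j := fun j =>
    (Finset.sum_eq_sum_iff_of_le fun j _ => hle j).1 hsum j (Finset.mem_univ j)
  have hS : 0 < ∑ j, |v j| := by
    obtain ⟨i, hi⟩ := Function.ne_iff.1 hv0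
    exact Finset.sum_pos' (fun j _ => abs_nonneg _) ⟨i, Finset.mem_univ _, abs_pos.2 hi⟩
  refine ⟨fun i => |v i| / ∑ j, |v j|, ⟨fun i => by positivity, ?_⟩, ?_⟩
  · rw [← Finset.sum_div, div_self hS.ne']
  · ext j
    change ∑ i, |v i| / (∑ j, |v j|) * P i j = _
    rw [heq j, Finset.sum_div]
    exact Finset.sum_congr rfl fun i _ => by ring

open scoped ENNReal NNReal

/-! ### Sub-Gaussian random vectors -/

lemma lintegral_exp_mul_gaussianReal (a : ℝ) :
    ∫⁻ g, ENNReal.ofReal (Real.exp (a * g)) ∂(gaussianReal 0 1) =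
      ENNReal.ofReal (Real.exp (a ^ 2 / 2)) := by
  have h := congrFun (mgf_fun_id_gaussianReal (μ := 0) (v := 1)) a
  rw [mgf] at h
  rw [← ofReal_integral_eq_lintegral_ofReal (integrable_exp_mul_gaussianReal a)
    (ae_of_all _ fun _ => (Real.exp_pos _).le), h]
  simp

lemma lintegral_exp_sq_gaussianReal_le :
    ∫⁻ g, ENNReal.ofReal (Real.exp (g ^ 2 / 4)) ∂(gaussianReal 0 1) ≤
      ENNReal.ofReal (Real.exp 1) := by
  have hd : ∀ x : ℝ, gaussianPDF 0 1 x * ENNReal.ofReal (Real.exp (x ^ 2 / 4)) =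
      ENNReal.ofReal ((√(2 * Real.pi))⁻¹ * Real.exp (-(1 / 4) * x ^ 2)) := fun x => by
    rw [gaussianPDF, ← ENNReal.ofReal_mul (gaussianPDFReal_nonneg _ _ _), gaussianPDFReal]
    congr 1
    rw [mul_assoc, ← Real.exp_add]
    simp only [NNReal.coe_one, mul_one, sub_zero]
    congr 2
    ring
  rw [gaussianReal_of_var_ne_zero _ one_ne_zero,
    lintegral_withDensity_eq_lintegral_mul _ (measurable_gaussianPDF _ _) (by fun_prop)]
  simp only [Pi.mul_apply, hd]
  have hint : Integrable (fun x : ℝ => (√(2 * Real.pi))⁻¹ * Real.exp (-(1 / 4) * x ^ 2)) :=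
    (integrable_exp_neg_mul_sq (by norm_num)).const_mul _
  rw [← ofReal_integral_eq_lintegral_ofReal hint (ae_of_all _ fun _ => by positivity),
    integral_const_mul, integral_gaussian]
  refine ENNReal.ofReal_le_ofReal ?_
  have h1 : √(Real.pi / (1 / 4)) = √2 * √(2 * Real.pi) := by
    rw [← Real.sqrt_mul (by norm_num)]
    congr 1
    ring
  have h2 : 0 < √(2 * Real.pi) := Real.sqrt_pos.2 (by positivity)
  rw [h1, mul_comm √2, ← mul_assoc, inv_mul_cancel₀ h2.ne', one_mul]
  have h3 : √2 ≤ 2 := Real.sqrt_le_iff.2 ⟨by norm_num, by norm_num⟩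
  linarith [Real.add_one_le_exp 1]

variable {Ω : Type*} [MeasurableSpace Ω] {μ : Measure Ω}

lemma HasSubgaussianMGF_mono {X : Ω → ℝ} {c c' : ℝ≥0} (h : HasSubgaussianMGF X c μ) (hc : c ≤ c') :
    HasSubgaussianMGF X c' μ where
  integrable_exp_mul := h.integrable_exp_mul
  mgf_le t := (h.mgf_le t).trans (by gcongr)

lemma lintegral_exp_le_of_hasSubgaussianMGF {X : Ω → ℝ} {c : ℝ≥0} (h : HasSubgaussianMGF X c μ) :
    ∫⁻ ω, ENNReal.ofReal (Real.exp (X ω)) ∂μ ≤ ENNReal.ofReal (Real.exp (c / 2)) := by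
  have hi := h.integrable_exp_mul 1
  have hm := h.mgf_le 1
  simp only [one_mul, mgf, one_pow, mul_one] at hi hm
  rw [← ofReal_integral_eq_lintegral_ofReal hi (ae_of_all _ fun _ => (Real.exp_pos _).le)]
  exact ENNReal.ofReal_le_ofReal hm

variable {ι : Type*} [Fintype ι]

lemma lintegral_pi_prod_eq_prod {ν : Measure ℝ} [IsProbabilityMeasure ν] {f : ι → ℝ → ℝ≥0∞}
    (hf : ∀ i, Measurable (f i)) :
    ∫⁻ g, ∏ i, f i (g i) ∂(Measure.pi fun _ : ι => ν) = ∏ i, ∫⁻ x, f i x ∂ν := by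
  rw [lintegral_prod_eq_prod_lintegral_of_indepFun Finset.univ
    (fun (i : ι) (g : ι → ℝ) => f i (g i)) (iIndepFun_pi fun i => (hf i).aemeasurable)
    fun i => (hf i).comp (measurable_pi_apply i)]
  refine Finset.prod_congr rfl fun i _ => ?_
  exact (measurePreserving_eval (fun _ : ι => ν) i).lintegral_comp (hf i)

/-- Gaussian linearization: the exponential of the squared norm is the average of `exp (κ ⟨g, Z⟩)`
over a standard Gaussian `g`, with `κ ^ 2 = 1 / (2 τ)`. After exchanging the integrals, the
sub-Gaussian bound leaves a product of integrals of `exp (g i ^ 2 / 4)`, each equal to `√2 ≤ e`. No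
independence of the coordinates of `Z` is needed. -/
lemma lintegral_prod_exp_le [SFinite μ] {Z : Ω → ι → ℝ} (hZm : Measurable Z) {τ : ℝ≥0} (hτ : 0 < τ)
    (hZ : ∀ v : ι → ℝ,
      HasSubgaussianMGF (fun ω => ∑ i, v i * Z ω i) (τ * Real.toNNReal (∑ i, v i ^ 2)) μ) :
    ∫⁻ ω, ENNReal.ofReal (Real.exp ((∑ i, Z ω i ^ 2) / (4 * τ))) ∂μ ≤
      ENNReal.ofReal (Real.exp (Fintype.card ι)) := by
  have hτ' : (0 : ℝ) < τ := hτ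
  set κ : ℝ := (√(2 * τ))⁻¹
  have hκ : κ ^ 2 = (2 * τ : ℝ)⁻¹ := by
    simp only [κ]
    rw [inv_pow, Real.sq_sqrt (by positivity)]
  have h1 : ∀ ω, ENNReal.ofReal (Real.exp ((∑ i, Z ω i ^ 2) / (4 * τ))) =
      ∫⁻ g, ENNReal.ofReal (Real.exp (∑ i, κ * g i * Z ω i))
        ∂(Measure.pi fun _ : ι => gaussianReal 0 1) := fun ω => by
    have hprod : ∀ g : ι → ℝ, ENNReal.ofReal (Real.exp (∑ i, κ * g i * Z ω i)) =
        ∏ i, ENNReal.ofReal (Real.exp (κ * Z ω i * g i)) := fun g => by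
      rw [Real.exp_sum, ENNReal.ofReal_prod_of_nonneg fun _ _ => (Real.exp_pos _).le]
      exact Finset.prod_congr rfl fun i _ => by ring_nf
    simp only [hprod]
    rw [lintegral_pi_prod_eq_prod (f := fun i g => ENNReal.ofReal (Real.exp (κ * Z ω i * g)))
      (fun i => by fun_prop)]
    simp only [lintegral_exp_mul_gaussianReal]
    rw [← ENNReal.ofReal_prod_of_nonneg fun _ _ => (Real.exp_pos _).le, ← Real.exp_sum,
      Finset.sum_div]
    congr 3
    ext i
    rw [mul_pow, hκ]
    field_simp
    ring
  simp only [h1]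
  rw [lintegral_lintegral_swap (by fun_prop)]
  have h2 : ∀ g : ι → ℝ, ∫⁻ ω, ENNReal.ofReal (Real.exp (∑ i, κ * g i * Z ω i)) ∂μ ≤
      ∏ i, ENNReal.ofReal (Real.exp (g i ^ 2 / 4)) := fun g => by
    refine (lintegral_exp_le_of_hasSubgaussianMGF (hZ fun i => κ * g i)).trans (le_of_eq ?_)
    rw [← ENNReal.ofReal_prod_of_nonneg fun _ _ => (Real.exp_pos _).le, ← Real.exp_sum,
      NNReal.coe_mul, Real.coe_toNNReal _ (Finset.sum_nonneg fun _ _ => sq_nonneg _),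
      ← Finset.sum_div]
    simp only [mul_pow, ← Finset.mul_sum, hκ]
    congr 2
    field_simp
    ring
  refine (lintegral_mono h2).trans ?_
  rw [lintegral_pi_prod_eq_prod (f := fun _ g => ENNReal.ofReal (Real.exp (g ^ 2 / 4)))
    (fun i => by fun_prop)]
  refine (Finset.prod_le_prod' fun i _ => lintegral_exp_sq_gaussianReal_le).trans (le_of_eq ?_)
  rw [Finset.prod_const, Finset.card_univ, ← ENNReal.ofReal_pow (Real.exp_pos _).le,
    ← Real.exp_nat_mul, mul_one]

lemma measureReal_le_sum_sq_le [IsProbabilityMeasure μ] {Z : Ω → ι → ℝ} (hZm : Measurable Z)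
    {τ : ℝ≥0} (hτ : 0 < τ)
    (hZ : ∀ v : ι → ℝ,
      HasSubgaussianMGF (fun ω => ∑ i, v i * Z ω i) (τ * Real.toNNReal (∑ i, v i ^ 2)) μ) (s : ℝ) :
    μ.real {ω | 4 * τ * (Fintype.card ι + s) ≤ ∑ i, Z ω i ^ 2} ≤ Real.exp (-s) := by
  have hτ' : (0 : ℝ) < τ := hτ
  refine ENNReal.toReal_le_of_le_ofReal (Real.exp_pos _).le ?_
  set r : ℝ≥0∞ := ENNReal.ofReal (Real.exp (Fintype.card ι + s))
  have hr0 : r ≠ 0 := by simp [r, Real.exp_pos]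
  have h := mul_meas_ge_le_lintegral₀ (μ := μ)
    (f := fun ω => ENNReal.ofReal (Real.exp ((∑ i, Z ω i ^ 2) / (4 * τ)))) (by fun_prop) r
  have hsub : {ω | 4 * τ * (Fintype.card ι + s) ≤ ∑ i, Z ω i ^ 2} ⊆
      {ω | r ≤ ENNReal.ofReal (Real.exp ((∑ i, Z ω i ^ 2) / (4 * τ)))} := fun ω hω => by
    refine ENNReal.ofReal_le_ofReal (Real.exp_le_exp.2 ?_)
    rw [le_div_iff₀ (by positivity)]
    simp only [Set.mem_ofPred_eq] at hω
    linarith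
  have h3 := h.trans (lintegral_prod_exp_le hZm hτ hZ)
  have h4 : μ {ω | r ≤ ENNReal.ofReal (Real.exp ((∑ i, Z ω i ^ 2) / (4 * τ)))} ≤
      ENNReal.ofReal (Real.exp (Fintype.card ι)) / r :=
    (ENNReal.le_div_iff_mul_le (Or.inl hr0) (Or.inl ENNReal.ofReal_ne_top)).2 (by rwa [mul_comm])
  refine (measure_mono hsub).trans (h4.trans (le_of_eq ?_))
  rw [← ENNReal.ofReal_div_of_pos (Real.exp_pos _), ← Real.exp_sub]
  congr 2
  ring

/-! ### Random matrices with sub-Gaussian linear forms -/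

/-- The points of the grid of mesh `1 / (2 N)` in the cube `[-1, 1]`, with `N` coordinates. -/
noncomputable def netPoint (k : ι → Fin (4 * Fintype.card ι + 1)) (i : ι) : ℝ :=
  ((k i : ℕ) : ℝ) / (2 * Fintype.card ι) - 1

/-- Rounding down costs at most `1 / (2 N)` in each coordinate, hence `√N / (2 N) ≤ 1 / 2` in norm.
This crude net has `(4 N + 1) ^ N` points, which is where the factor `log N` in the operator bound
comes from. -/
lemma exists_netPoint_close [Nonempty ι] {x : ι → ℝ} (hx : l2 x ≤ 1) :
    ∃ k : ι → Fin (4 * Fintype.card ι + 1), l2 (x - netPoint k) ≤ 1 / 2 := by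
  set N := Fintype.card ι
  have hN : 1 ≤ N := Fintype.card_pos
  have hN' : (1 : ℝ) ≤ N := by exact_mod_cast hN
  have hx1 : ∀ i, |x i| ≤ 1 := fun i => by
    rw [← sq_le_one_iff_abs_le_one]
    calc x i ^ 2 ≤ ∑ j, x j ^ 2 :=
          Finset.single_le_sum (f := fun j => x j ^ 2) (fun j _ => sq_nonneg _) (Finset.mem_univ i)
      _ = l2 x ^ 2 := (l2_sq x).symm
      _ ≤ 1 := pow_le_one₀ (l2_nonneg x) hx
  have hfl : ∀ i, ⌊(x i + 1) * (2 * N)⌋₊ < 4 * N + 1 := fun i => by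
    have h := abs_le.1 (hx1 i)
    rw [Nat.lt_succ_iff]
    refine Nat.floor_le_of_le ?_
    push_cast
    nlinarith
  refine ⟨fun i => ⟨⌊(x i + 1) * (2 * N)⌋₊, hfl i⟩, ?_⟩
  have hd : ∀ i, |(x - netPoint fun i => ⟨⌊(x i + 1) * (2 * N)⌋₊, hfl i⟩) i| ≤ 1 / (2 * N) :=
    fun i => by
    have h0 : 0 ≤ (x i + 1) * (2 * N) := by
      have h := abs_le.1 (hx1 i)
      nlinarith
    have h1 := Nat.floor_le h0
    have h2 := (Nat.lt_floor_add_one ((x i + 1) * (2 * N))).le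
    have h3 : (x - netPoint fun i => ⟨⌊(x i + 1) * (2 * N)⌋₊, hfl i⟩) i =
        ((x i + 1) * (2 * N) - ⌊(x i + 1) * (2 * N)⌋₊) / (2 * N) := by
      simp only [Pi.sub_apply, netPoint]
      field_simp
      ring
    rw [h3, abs_of_nonneg (div_nonneg (by linarith) (by positivity))]
    gcongr
    linarith
  refine (l2_le_of_abs_le hd).trans ?_
  rw [l2_const (by positivity)]
  have hs : √(N : ℝ) ≤ N := Real.sqrt_le_self_iff.2 (Or.inr hN')
  rw [mul_one_div, div_le_div_iff₀ (by positivity) (by positivity)]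
  linarith

/-- A unit vector is a net point plus a remainder of norm at most `1 / 2`, so the operator norm
satisfies `‖f‖ ≤ C + ‖f‖ / 2`. Only net points of norm at most `2` occur. -/
lemma l2_vecMul_le_of_net (X : ι → ι → ℝ) {C : ℝ}
    (h : ∀ k : ι → Fin (4 * Fintype.card ι + 1), l2 (netPoint k) ≤ 2 →
      l2 (fun j => ∑ i, netPoint k i * X i j) ≤ C) (x : ι → ℝ) :
    l2 (fun j => ∑ i, x i * X i j) ≤ 2 * C * l2 x := by
  classical
  rcases isEmpty_or_nonempty ι with hι | hι
  · rw [Subsingleton.elim (fun j => ∑ i, x i * X i j) x, Subsingleton.elim x 0]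
    simp [l2]
  set f := Matrix.toEuclideanCLM (𝕜 := ℝ) (Matrix.of fun j i => X i j)
  have hf : ∀ y : ι → ℝ, l2 (fun j => ∑ i, y i * X i j) = ‖f (WithLp.toLp 2 y)‖ := fun y => by
    rw [Matrix.toEuclideanCLM_toLp, l2]
    congr 2
    ext j
    simp [Matrix.mulVec, dotProduct, mul_comm]
  have hbound : ‖f‖ ≤ C + ‖f‖ * (1 / 2) := by
    refine ContinuousLinearMap.opNorm_le_of_unit_norm (𝕜 := ℝ) ?_ ?_
    · obtain ⟨k, hk⟩ := exists_netPoint_close (x := (0 : ι → ℝ)) (by simp [l2])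
      have hk2 : l2 (netPoint k) ≤ 2 := by
        rw [zero_sub, l2_neg] at hk
        linarith
      have := (l2_nonneg _).trans (h k hk2)
      positivity
    · intro z hz
      obtain ⟨k, hk⟩ := exists_netPoint_close (x := z.ofLp) (by simp [l2, hz])
      have hk2 : l2 (netPoint k) ≤ 2 := by
        have := l2_sub_le z.ofLp (z.ofLp - netPoint k)
        rw [sub_sub_cancel] at this
        have hz1 : l2 z.ofLp = 1 := by simp [l2, hz]
        linarith
      have h1 := h k hk2
      rw [hf] at h1
      have h2 : f z = f (WithLp.toLp 2 (netPoint k)) + f (WithLp.toLp 2 (z.ofLp - netPoint k)) := by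
        rw [← map_add, ← WithLp.toLp_add, add_sub_cancel, WithLp.toLp_ofLp]
      rw [h2]
      refine (norm_add_le _ _).trans (add_le_add h1 ((f.le_opNorm _).trans ?_))
      gcongr
      exact hk
  rw [hf]
  refine (f.le_opNorm _).trans ?_
  rw [l2]
  gcongr
  linarith

/-- The linear forms of the random matrix `X` are sub-Gaussian, with variance proxy `s` times the
square of the Euclidean norm of the coefficients. -/
structure IsSubgaussianMatrix (X : Ω → ι → ι → ℝ) (s : ℝ≥0) (μ : Measure Ω) : Prop where
  measurable : Measurable X
  hasSubgaussianMGF : ∀ c : ι → ι → ℝ, HasSubgaussianMGF (fun ω => ∑ i, ∑ j, c i j * X ω i j)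
    (s * Real.toNNReal (∑ i, ∑ j, c i j ^ 2)) μ

namespace IsSubgaussianMatrix

variable {X : Ω → ι → ι → ℝ} {s : ℝ≥0}

lemma measureReal_rowSum_le [IsProbabilityMeasure μ] (hX : IsSubgaussianMatrix X s μ) {a : ℝ}
    (ha : 0 ≤ a) :
    μ.real {ω | ∃ i, a ≤ |∑ j, X ω i j|} ≤
      Fintype.card ι * (2 * Real.exp (-a ^ 2 / (2 * (s * Fintype.card ι)))) := by
  classical
  have hrow : ∀ o, HasSubgaussianMGF (fun ω => ∑ j, X ω o j) (s * Fintype.card ι) μ := fun o => by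
    have h := hX.hasSubgaussianMGF fun i _ => if i = o then 1 else 0
    simpa [ite_pow, Finset.sum_ite_eq', ite_mul, Finset.sum_comm (γ := ι)] using h
  have hsub : {ω | ∃ i, a ≤ |∑ j, X ω i j|} ⊆
      ⋃ i, ({ω | a ≤ ∑ j, X ω i j} ∪ {ω | a ≤ (-fun ω => ∑ j, X ω i j) ω}) := by
    rintro ω ⟨i, hi⟩
    exact Set.mem_iUnion.2 ⟨i, le_abs.1 hi⟩
  refine (measureReal_mono hsub).trans ((measureReal_iUnion_fintype_le _).trans ?_)
  rw [← nsmul_eq_mul, ← Finset.card_univ]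
  refine Finset.sum_le_card_nsmul _ _ _ fun i _ => (measureReal_union_le _ _).trans ?_
  rw [two_mul]
  have h1 := (hrow i).measure_ge_le ha
  have h2 := (hrow i).neg.measure_ge_le ha
  push_cast at h1 h2
  exact add_le_add h1 h2

lemma measureReal_vecMul_le [IsProbabilityMeasure μ] (hX : IsSubgaussianMatrix X s μ) (hs : 0 < s)
    {u : ι → ℝ} (hu : l2 u ≤ 2) (t : ℝ) :
    μ.real {ω | 16 * s * (Fintype.card ι + t) ≤ l2 (fun j => ∑ i, u i * X ω i j) ^ 2} ≤
      Real.exp (-t) := by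
  have hXm := hX.measurable
  have h := measureReal_le_sum_sq_le (μ := μ) (Z := fun ω j => ∑ i, u i * X ω i j) (by fun_prop)
    (τ := 4 * s) (by positivity) (fun v => ?_) t
  · push_cast at h
    simpa only [l2_sq, ← mul_assoc, show (4 : ℝ) * 4 = 16 by norm_num] using h
  -- Pairing the vector with `v` is the linear form with coefficients `u i * v j`, whose squared
  -- norm is `l2 u ^ 2 * l2 v ^ 2 ≤ 4 * l2 v ^ 2`; hence `τ = 4 s`.
  · have h := hX.hasSubgaussianMGF fun i j => u i * v j
    have heq : ∀ ω, ∑ i, ∑ j, u i * v j * X ω i j = ∑ j, v j * ∑ i, u i * X ω i j := fun ω => by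
      rw [Finset.sum_comm]
      refine Finset.sum_congr rfl fun j _ => ?_
      rw [Finset.mul_sum]
      exact Finset.sum_congr rfl fun i _ => by ring
    simp only [heq] at h
    refine HasSubgaussianMGF_mono h ?_
    have h2 : ∑ i, ∑ j, (u i * v j) ^ 2 = l2 u ^ 2 * ∑ j, v j ^ 2 := by
      rw [l2_sq, Finset.sum_mul_sum]
      simp only [mul_pow]
    have h4 : l2 u ^ 2 ≤ 4 := by nlinarith [l2_nonneg u]
    rw [h2, mul_comm 4 s, mul_assoc, Real.toNNReal_mul (sq_nonneg _)]
    gcongr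
    exact Real.toNNReal_le_iff_le_coe.2 h4

/-- Pairing the flow with `v` gives the linear form with coefficients `x i * (v j - v i)`, whose
squares sum to at most `4 m ^ 2 N * l2 v ^ 2`. For one fixed `x` no net is needed, so no logarithm
appears. -/
lemma measureReal_flow_le [IsProbabilityMeasure μ] (hX : IsSubgaussianMatrix X s μ) (hs : 0 < s)
    {x : ι → ℝ} {m : ℝ≥0} (hm : 0 < m) (hx : ∀ i, |x i| ≤ m) [Nonempty ι] (t : ℝ) :
    μ.real {ω | 16 * s * m ^ 2 * Fintype.card ι * (Fintype.card ι + t) ≤ l2 (flow (X ω) x) ^ 2} ≤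
      Real.exp (-t) := by
  have hXm := hX.measurable
  have hN : (0 : ℝ≥0) < Fintype.card ι := by exact_mod_cast Fintype.card_pos
  have h := measureReal_le_sum_sq_le (μ := μ) (Z := fun ω => flow (X ω) x)
    (by unfold flow; fun_prop)
    (τ := 4 * s * m ^ 2 * Fintype.card ι) (by positivity) (fun v => ?_) t
  · push_cast at h
    simpa only [l2_sq, ← mul_assoc, show (4 : ℝ) * 4 = 16 by norm_num] using h
  · have h := hX.hasSubgaussianMGF fun i j => x i * (v j - v i)
    have heq : ∀ ω, ∑ i, ∑ j, x i * (v j - v i) * X ω i j = ∑ j, v j * flow (X ω) x j := fun ω => by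
      simp only [flow, mul_sub, sub_mul, Finset.sum_sub_distrib, Finset.mul_sum]
      congr 1
      · rw [Finset.sum_comm]
        exact Finset.sum_congr rfl fun i _ => Finset.sum_congr rfl fun j _ => by ring
      · exact Finset.sum_congr rfl fun i _ => Finset.sum_congr rfl fun j _ => by ring
    simp only [heq] at h
    refine HasSubgaussianMGF_mono h ?_
    have h2 : ∑ i, ∑ j, (x i * (v j - v i)) ^ 2 ≤
        4 * m ^ 2 * Fintype.card ι * ∑ j, v j ^ 2 :=
      calc ∑ i, ∑ j, (x i * (v j - v i)) ^ 2 ≤ ∑ i, ∑ j, 2 * (m : ℝ) ^ 2 * (v j ^ 2 + v i ^ 2) := by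
            refine Finset.sum_le_sum fun i _ => Finset.sum_le_sum fun j _ => ?_
            have hxm : x i ^ 2 ≤ (m : ℝ) ^ 2 := sq_le_sq' (abs_le.1 (hx i)).1 (abs_le.1 (hx i)).2
            rw [mul_pow]
            calc x i ^ 2 * (v j - v i) ^ 2 ≤ (m : ℝ) ^ 2 * (2 * (v j ^ 2 + v i ^ 2)) := by
                  gcongr
                  nlinarith [sq_nonneg (v j + v i)]
              _ = _ := by ring
        _ = _ := by
            simp only [← Finset.mul_sum, Finset.sum_add_distrib, Finset.sum_const, nsmul_eq_mul,
              Finset.card_univ]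
            ring
    have h3 : Real.toNNReal (4 * m ^ 2 * Fintype.card ι * ∑ j, v j ^ 2) =
        4 * m ^ 2 * Fintype.card ι * Real.toNNReal (∑ j, v j ^ 2) := by
      rw [Real.toNNReal_mul (by positivity)]
      congr 1
      rw [Real.toNNReal_eq_iff_eq_coe (by positivity)]
      push_cast
      rfl
    calc s * Real.toNNReal (∑ i, ∑ j, (x i * (v j - v i)) ^ 2) ≤
        s * Real.toNNReal (4 * m ^ 2 * Fintype.card ι * ∑ j, v j ^ 2) := by gcongr
      _ = _ := by rw [h3]; ring

lemma measureReal_net_le [IsProbabilityMeasure μ] (hX : IsSubgaussianMatrix X s μ) (hs : 0 < s)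
    (hN : 2 ≤ Fintype.card ι) :
    μ.real {ω | ∃ k : ι → Fin (4 * Fintype.card ι + 1), l2 (netPoint k) ≤ 2 ∧
      16 * s * (Fintype.card ι + 9 * (Fintype.card ι * Real.log (Fintype.card ι))) ≤
        l2 (fun j => ∑ i, netPoint k i * X ω i j) ^ 2} ≤
      Real.exp (-(10 * Real.log (Fintype.card ι))) := by
  classical
  set N := Fintype.card ι
  have hN' : (2 : ℝ) ≤ N := by exact_mod_cast hN
  have hN0 : (0 : ℝ) < N := by linarith
  have hlog : 0 ≤ Real.log N := Real.log_nonneg (by linarith)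
  -- The net has at most `exp (4 N log N)` points, so `exp (-5 N log N)` is left after the union
  -- bound, and `N ≥ 2` makes this at most `N ^ (-10)`.
  set t : ℝ := 9 * (N * Real.log N)
  have hsub : {ω | ∃ k : ι → Fin (4 * N + 1), l2 (netPoint k) ≤ 2 ∧
      16 * s * (N + t) ≤ l2 (fun j => ∑ i, netPoint k i * X ω i j) ^ 2} ⊆
      ⋃ k : ι → Fin (4 * N + 1), {ω | l2 (netPoint k) ≤ 2 ∧
        16 * s * (N + t) ≤ l2 (fun j => ∑ i, netPoint k i * X ω i j) ^ 2} := by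
    rintro ω ⟨k, hk⟩
    exact Set.mem_iUnion.2 ⟨k, hk⟩
  refine (measureReal_mono hsub).trans ((measureReal_iUnion_fintype_le _).trans ?_)
  have hterm : ∀ k : ι → Fin (4 * N + 1), μ.real {ω | l2 (netPoint k) ≤ 2 ∧
      16 * s * (N + t) ≤ l2 (fun j => ∑ i, netPoint k i * X ω i j) ^ 2} ≤ Real.exp (-t) := by
    intro k
    by_cases hk : l2 (netPoint k) ≤ 2
    · simpa only [hk, true_and] using hX.measureReal_vecMul_le hs hk t
    · simp only [hk, false_and, Set.ofPred_false, measureReal_empty]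
      exact (Real.exp_pos _).le
  refine (Finset.sum_le_card_nsmul _ _ _ fun k _ => hterm k).trans ?_
  have hcard : (4 * N + 1 : ℝ) ≤ Real.exp (4 * Real.log N) := by
    have h : Real.exp (4 * Real.log N) = (N : ℝ) ^ 4 := by
      rw [← Real.exp_log hN0, ← Real.exp_nat_mul, Real.exp_log hN0]
      norm_num
    rw [h]
    nlinarith [sq_nonneg ((N : ℝ) ^ 2 - 4), mul_self_nonneg ((N : ℝ) - 2)]
  have hpow : ((4 * N + 1 : ℝ)) ^ N ≤ Real.exp (4 * (N * Real.log N)) :=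
    calc _ ≤ Real.exp (4 * Real.log N) ^ N := by gcongr
      _ = _ := by
        rw [← Real.exp_nat_mul]
        ring_nf
  rw [Finset.card_univ, Fintype.card_fun, Fintype.card_fin, nsmul_eq_mul]
  push_cast
  calc _ ≤ Real.exp (4 * (N * Real.log N)) * Real.exp (-t) := by gcongr
    _ = Real.exp (-(5 * (N * Real.log N))) := by
      rw [← Real.exp_add]
      simp only [t]
      ring_nf
    _ ≤ _ := by
      refine Real.exp_le_exp.2 ?_
      nlinarith

/-- With high probability, the flow of a sub-Gaussian random matrix is bounded on all vectors, and
on a fixed flat vector it is smaller by a logarithmic factor. -/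
lemma measureReal_flow_bounds [IsProbabilityMeasure μ] (hX : IsSubgaussianMatrix X s μ)
    (hs : 0 < s) (hN : 2 ≤ Fintype.card ι)
    (hlogN : 10 * Real.log (Fintype.card ι) ≤ Fintype.card ι)
    {x : ι → ℝ} {m : ℝ} (hm : 0 < m) (hx : ∀ i, |x i| ≤ m) :
    μ.real {ω | ¬((∀ y, l2 (flow (X ω) y) ≤
        33 * √(s * (Fintype.card ι * Real.log (Fintype.card ι))) * l2 y) ∧
      l2 (flow (X ω) x) ≤ 6 * √s * m * Fintype.card ι)} ≤ 4 / (Fintype.card ι : ℝ) ^ 10 := by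
  have : Nonempty ι := Fintype.card_pos_iff.1 (by omega)
  -- With `r = √(s N log N)`, the level `5 r` gives the tail `2 N * N ^ (-25 / 2)`. The net bound
  -- `14 r` becomes `28 r` for all vectors, and `28 + 5 = 33`.
  have h1 := hX.measureReal_rowSum_le
    (a := 5 * √(s * (Fintype.card ι * Real.log (Fintype.card ι)))) (by positivity)
  have h2 := hX.measureReal_net_le hs hN
  have h3 := hX.measureReal_flow_le hs (m := ⟨m, hm.le⟩) hm hx (Fintype.card ι)
  set N := Fintype.card ι
  have hN' : (2 : ℝ) ≤ N := by exact_mod_cast hN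
  have hN0 : (0 : ℝ) < N := by linarith
  have hs' : (0 : ℝ) < s := hs
  have hlog : 1 / 2 ≤ Real.log N := by
    have h := Real.log_le_log (by norm_num) hN'
    linarith [Real.log_two_gt_d9]
  set r : ℝ := √(s * (N * Real.log N))
  have hr0 : 0 ≤ r := Real.sqrt_nonneg _
  have hr : r ^ 2 = s * (N * Real.log N) := Real.sq_sqrt (by positivity)
  have hexp : Real.exp (-(10 * Real.log N)) = 1 / (N : ℝ) ^ 10 := by
    rw [Real.exp_neg, one_div, ← Real.log_rpow hN0, Real.exp_log (by positivity)]
    norm_cast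
  have h1' : N * (2 * Real.exp (-(5 * r) ^ 2 / (2 * (s * N)))) ≤ 2 / (N : ℝ) ^ 10 := by
    have ha : -(5 * r) ^ 2 / (2 * (s * N)) = -(25 / 2 * Real.log N) := by
      rw [mul_pow, hr]
      field_simp
      ring
    have hb : N * Real.exp (-(25 / 2 * Real.log N)) ≤ Real.exp (-(10 * Real.log N)) := by
      nth_rw 1 [← Real.exp_log hN0]
      rw [← Real.exp_add]
      exact Real.exp_le_exp.2 (by linarith)
    rw [ha]
    calc _ = 2 * (N * Real.exp (-(25 / 2 * Real.log N))) := by ring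
      _ ≤ 2 * Real.exp (-(10 * Real.log N)) := by gcongr
      _ = _ := by rw [hexp]; ring
  have h3' : Real.exp (-N) ≤ 1 / (N : ℝ) ^ 10 := by
    rw [← hexp]
    exact Real.exp_le_exp.2 (by linarith)
  rw [hexp] at h2
  set S₁ := {ω | ∃ i, 5 * r ≤ |∑ j, X ω i j|}
  set S₂ := {ω | ∃ k : ι → Fin (4 * N + 1), l2 (netPoint k) ≤ 2 ∧
      16 * s * (N + 9 * (N * Real.log N)) ≤ l2 (fun j => ∑ i, netPoint k i * X ω i j) ^ 2}
  set S₃ := {ω | 16 * s * ((⟨m, hm.le⟩ : ℝ≥0) : ℝ) ^ 2 * N * (N + N) ≤ l2 (flow (X ω) x) ^ 2}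
  have hsub : {ω | ¬((∀ y, l2 (flow (X ω) y) ≤ 33 * r * l2 y) ∧
      l2 (flow (X ω) x) ≤ 6 * √s * m * N)} ⊆ S₁ ∪ (S₂ ∪ S₃) := by
    intro ω hω
    by_contra hcon
    simp only [Set.mem_union, not_or] at hcon
    obtain ⟨hc1, hc2, hc3⟩ := hcon
    simp only [S₁, S₂, S₃, Set.mem_ofPred_eq, not_exists, not_and, not_le] at hc1 hc2 hc3
    refine hω ⟨fun y => ?_, ?_⟩
    · have hnet := l2_vecMul_le_of_net (X ω) (C := 14 * r) (fun k hk => ?_) y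
      · refine (l2_flow_le (X ω) (fun j => (hc1 j).le) hnet).trans (le_of_eq ?_)
        ring
      · refine le_of_sq_le_sq ((hc2 k hk).le.trans ?_) (by positivity)
        rw [mul_pow, hr]
        -- Hence `16 (N + 9 N log N) ≤ 176 N log N`, below `14 ^ 2 = 196` times `N log N`.
        have : (N : ℝ) ≤ 2 * (N * Real.log N) := by nlinarith
        nlinarith
    · refine le_of_sq_le_sq (hc3.le.trans ?_) (by positivity)
      rw [mul_pow, mul_pow, mul_pow, Real.sq_sqrt hs'.le]
      change 16 * s * m ^ 2 * N * (N + N) ≤ _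
      have : 0 ≤ s * m ^ 2 * (N : ℝ) ^ 2 := by positivity
      nlinarith
  calc _ ≤ μ.real (S₁ ∪ (S₂ ∪ S₃)) := measureReal_mono hsub
    _ ≤ μ.real S₁ + (μ.real S₂ + μ.real S₃) :=
      (measureReal_union_le _ _).trans (by gcongr; exact measureReal_union_le _ _)
    _ ≤ 2 / (N : ℝ) ^ 10 + (1 / (N : ℝ) ^ 10 + 1 / (N : ℝ) ^ 10) :=
      add_le_add (h1.trans h1') (add_le_add h2 (h3.trans h3'))
    _ = _ := by ring

end IsSubgaussianMatrix

/-! ### The number of comparison times of a pair -/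

lemma binomialRandom_adj {V : Type*} [Countable V] (p : unitInterval) {i j : V} (hij : i ≠ j) :
    SimpleGraph.binomialRandom V p {g | g.Adj i j} = ENNReal.ofReal p := by
  have hmeas : MeasurableSet {g : SimpleGraph V | g.Adj i j} :=
    measurableSet_setOfPred.2 (SimpleGraph.measurable_iff_adj.1 measurable_id i j)
  rw [SimpleGraph.binomialRandom_eq_map, Measure.map_apply (by fun_prop) hmeas]
  have hpre : SimpleGraph.fromEdgeSet ⁻¹' {g : SimpleGraph V | g.Adj i j} =
      {S : Set (Sym2 V) | s(i, j) ∈ S} := by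
    ext S
    simp [hij]
  rw [hpre, setBernoulli_apply']
  have hpre2 : (fun p : Sym2 V → Prop => {e | p e}) ⁻¹' {S : Set (Sym2 V) | s(i, j) ∈ S} =
      (fun f : Sym2 V → Prop => f s(i, j)) ⁻¹' {True} := by
    ext f
    simp
  rw [hpre2, ← Measure.map_apply (by fun_prop) (MeasurableSet.singleton _),
    Measure.infinitePi_map_eval]
  simp [hij]
  rw [ENNReal.ofReal_eq_coe_nnreal p.2.1]
  rfl

/-- Needed to condition on the value of the graph sequence. -/
instance {V : Type*} [Countable V] : MeasurableSingletonClass (SimpleGraph V) where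
  measurableSet_singleton g := by
    have h : {g} = (SimpleGraph.Adj : SimpleGraph V → V → V → Prop) ⁻¹' {g.Adj} := by
      ext g'
      exact SimpleGraph.ext_iff
    rw [h]
    exact SimpleGraph.measurable_adj (MeasurableSet.singleton _)

open scoped Classical in
/-- Lower tail of a sum of independent Bernoulli variables. -/
lemma measureReal_sum_bernoulli_le {κ : Type*} {B : κ → Ω → Prop} {p : κ → ℝ}
    (hB : ∀ k, Measurable (B k)) (hp : ∀ k, p k ∈ Set.Icc (0 : ℝ) 1)
    (hμ : ∀ k, μ {ω | B k ω} = ENNReal.ofReal (p k)) (hind : iIndepFun B μ) (s : Finset κ) :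
    μ.real {ω | ∑ k ∈ s, (if B k ω then (1 : ℝ) else 0) ≤ (∑ k ∈ s, p k) / 4} ≤
      Real.exp (-(7 / 20 * ∑ k ∈ s, p k)) := by
  have hprob : IsProbabilityMeasure μ := hind.isProbabilityMeasure
  have hφ : Measurable fun b : Prop => ENNReal.ofReal (Real.exp (-(if b then (1 : ℝ) else 0))) :=
    measurable_from_top
  -- Chernoff's method with parameter `1`: `1 - (1 - 1 / e) p ≤ exp (-3 p / 5)`. The threshold of
  -- one quarter of the mean then leaves `3 / 5 - 1 / 4 = 7 / 20`.
  have hmgf : ∀ k, ∫⁻ ω, ENNReal.ofReal (Real.exp (-(if B k ω then (1 : ℝ) else 0))) ∂μ ≤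
      ENNReal.ofReal (Real.exp (-(3 / 5 * p k))) := fun k => by
    have hset : MeasurableSet {ω | B k ω} := measurableSet_setOfPred.2 (hB k)
    have hfun : ∀ ω, ENNReal.ofReal (Real.exp (-(if B k ω then (1 : ℝ) else 0))) =
        {ω | B k ω}.indicator (fun _ => ENNReal.ofReal (Real.exp (-1))) ω +
          {ω | B k ω}ᶜ.indicator (fun _ => 1) ω := fun ω => by
      by_cases h : B k ω <;> simp [h]
    simp only [hfun]
    rw [lintegral_add_left (measurable_const.indicator hset), lintegral_indicator_const hset,
      lintegral_indicator_const hset.compl, prob_compl_eq_one_sub hset, hμ k, one_mul,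
      ← ENNReal.ofReal_mul (Real.exp_pos _).le, ← ENNReal.ofReal_one,
      ← ENNReal.ofReal_sub _ (hp k).1, ← ENNReal.ofReal_add
        (mul_nonneg (Real.exp_pos _).le (hp k).1) (by linarith [(hp k).2])]
    refine ENNReal.ofReal_le_ofReal ?_
    have h1 : Real.exp (-1) ≤ 2 / 5 := by
      rw [Real.exp_neg, inv_le_comm₀ (Real.exp_pos _) (by norm_num)]
      linarith [Real.exp_one_gt_d9]
    have h2 := Real.add_one_le_exp (-(3 / 5 * p k))
    nlinarith [(hp k).1]
  have hprod : ∫⁻ ω, ∏ k ∈ s, ENNReal.ofReal (Real.exp (-(if B k ω then (1 : ℝ) else 0))) ∂μ ≤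
      ENNReal.ofReal (Real.exp (-(3 / 5 * ∑ k ∈ s, p k))) := by
    have hcomp : iIndepFun
        (fun k ω => ENNReal.ofReal (Real.exp (-(if B k ω then (1 : ℝ) else 0)))) μ :=
      hind.comp _ fun _ => hφ
    rw [lintegral_prod_eq_prod_lintegral_of_indepFun s _ hcomp fun k => hφ.comp (hB k)]
    refine (Finset.prod_le_prod' fun k _ => hmgf k).trans (le_of_eq ?_)
    rw [← ENNReal.ofReal_prod_of_nonneg fun _ _ => (Real.exp_pos _).le, ← Real.exp_sum,
      Finset.sum_neg_distrib, Finset.mul_sum]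
  refine ENNReal.toReal_le_of_le_ofReal (Real.exp_pos _).le ?_
  set r : ℝ≥0∞ := ENNReal.ofReal (Real.exp (-((∑ k ∈ s, p k) / 4)))
  have hr0 : r ≠ 0 := by simp [r, Real.exp_pos]
  have h := mul_meas_ge_le_lintegral₀ (μ := μ)
    (f := fun ω => ∏ k ∈ s, ENNReal.ofReal (Real.exp (-(if B k ω then (1 : ℝ) else 0))))
    (Finset.measurable_prod _ fun k _ => hφ.comp (hB k)).aemeasurable r
  have hsub : {ω | ∑ k ∈ s, (if B k ω then (1 : ℝ) else 0) ≤ (∑ k ∈ s, p k) / 4} ⊆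
      {ω | r ≤ ∏ k ∈ s, ENNReal.ofReal (Real.exp (-(if B k ω then (1 : ℝ) else 0)))} :=
    fun ω hω => by
    simp only [Set.mem_ofPred_eq] at hω ⊢
    rw [← ENNReal.ofReal_prod_of_nonneg fun _ _ => (Real.exp_pos _).le, ← Real.exp_sum,
      Finset.sum_neg_distrib]
    exact ENNReal.ofReal_le_ofReal (Real.exp_le_exp.2 (neg_le_neg hω))
  have h4 : μ {ω | r ≤ ∏ k ∈ s, ENNReal.ofReal (Real.exp (-(if B k ω then (1 : ℝ) else 0)))} ≤
      ENNReal.ofReal (Real.exp (-(3 / 5 * ∑ k ∈ s, p k))) / r :=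
    (ENNReal.le_div_iff_mul_le (Or.inl hr0) (Or.inl ENNReal.ofReal_ne_top)).2
      (by rw [mul_comm]; exact h.trans hprod)
  refine (measure_mono hsub).trans (h4.trans (le_of_eq ?_))
  rw [← ENNReal.ofReal_div_of_pos (Real.exp_pos _), ← Real.exp_sub]
  congr 2
  ring

/-- With high probability, every pair of items is compared at many times in the neighbourhood. -/
lemma measureReal_card_nbhdPair_le {n T : ℕ} {p : Fin (T + 1) → unitInterval}
    {G : Fin (T + 1) → Ω → SimpleGraph (Fin n)} (hmeas : ∀ k, Measurable (G k))
    (hlaw : ∀ k, HasLaw (G k) (SimpleGraph.binomialRandom (Fin n) (p k)) μ)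
    (hind : iIndepFun G μ) (δ t : ℝ) :
    μ.real {ω | ∃ i j, i ≠ j ∧
        ((nbhdPair (fun k => G k ω) δ t i j).card : ℝ) ≤ pSum p δ t / 4} ≤
      (n : ℝ) ^ 2 * Real.exp (-(7 / 20 * pSum p δ t)) := by
  have hprob : IsProbabilityMeasure μ := hind.isProbabilityMeasure
  have hsub : {ω | ∃ i j, i ≠ j ∧
      ((nbhdPair (fun k => G k ω) δ t i j).card : ℝ) ≤ pSum p δ t / 4} ⊆
      ⋃ e : Fin n × Fin n, {ω | e.1 ≠ e.2 ∧
        ((nbhdPair (fun k => G k ω) δ t e.1 e.2).card : ℝ) ≤ pSum p δ t / 4} := by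
    rintro ω ⟨i, j, h⟩
    exact Set.mem_iUnion.2 ⟨(i, j), h⟩
  have hterm : ∀ e : Fin n × Fin n, μ.real {ω | e.1 ≠ e.2 ∧
      ((nbhdPair (fun k => G k ω) δ t e.1 e.2).card : ℝ) ≤ pSum p δ t / 4} ≤
      Real.exp (-(7 / 20 * pSum p δ t)) := by
    rintro ⟨i, j⟩
    by_cases hij : i = j
    · simp only [hij, ne_eq, not_true_eq_false, false_and, Set.ofPred_false, measureReal_empty]
      exact (Real.exp_pos _).le
    have hadj : Measurable fun g : SimpleGraph (Fin n) => g.Adj i j :=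
      SimpleGraph.measurable_iff_adj.1 measurable_id i j
    have h := measureReal_sum_bernoulli_le (μ := μ) (B := fun k ω => (G k ω).Adj i j)
      (p := fun k => (p k : ℝ)) (fun k => hadj.comp (hmeas k)) (fun k => (p k).2)
      (fun k => by
        rw [(hlaw k).measure_eq (measurableSet_setOfPred.2 hadj), binomialRandom_adj _ hij])
      (hind.comp (fun _ g => g.Adj i j) fun _ => hadj) (nbhd T δ t)
    refine le_trans (measureReal_mono ?_) h
    rintro ω ⟨-, hω⟩
    simp only [Set.mem_ofPred_eq]
    rw [nbhdPair, Finset.card_filter] at hω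
    push_cast at hω
    exact hω
  refine (measureReal_mono hsub).trans ((measureReal_iUnion_fintype_le _).trans ?_)
  refine (Finset.sum_le_card_nsmul _ _ _ fun k _ => hterm k).trans (le_of_eq ?_)
  rw [Finset.card_univ, Fintype.card_prod, Fintype.card_fin, nsmul_eq_mul]
  push_cast
  ring

/-! ### Conditioning on a finitely valued random variable -/

/-- Since `U` takes finitely many values, the event splits into slices `U = a`; independence factors
each slice, and the weights of the slices sum to one. -/
lemma measureReal_le_of_indepFun {α β : Type*} [Finite α] [MeasurableSpace α]
    [MeasurableSingletonClass α] [MeasurableSpace β] [IsProbabilityMeasure μ] {U : Ω → α}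
    {V : Ω → β} (hU : Measurable U) (h : IndepFun U V μ) {good : Set α} {S : α → Set β}
    (hS : ∀ a, MeasurableSet (S a)) {ε : ℝ} (hε : 0 ≤ ε)
    (hbound : ∀ a ∈ good, μ.real (V ⁻¹' S a) ≤ ε) :
    μ.real {ω | U ω ∈ good ∧ V ω ∈ S (U ω)} ≤ ε := by
  classical
  cases nonempty_fintype α
  have hsub : {ω | U ω ∈ good ∧ V ω ∈ S (U ω)} ⊆
      ⋃ a : α, {ω | a ∈ good ∧ U ω = a ∧ V ω ∈ S a} := fun ω hω =>
    Set.mem_iUnion.2 ⟨U ω, hω.1, rfl, hω.2⟩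
  have hterm : ∀ a : α, μ.real {ω | a ∈ good ∧ U ω = a ∧ V ω ∈ S a} ≤ μ.real (U ⁻¹' {a}) * ε := by
    intro a
    by_cases ha : a ∈ good
    · have h1 : {ω | a ∈ good ∧ U ω = a ∧ V ω ∈ S a} = U ⁻¹' {a} ∩ V ⁻¹' S a := by
        ext ω
        simp [ha]
      have h2 := h.measure_inter_preimage_eq_mul {a} (S a) (MeasurableSet.singleton a) (hS a)
      rw [h1, measureReal_def, h2, ENNReal.toReal_mul]
      exact mul_le_mul_of_nonneg_left (hbound a ha) ENNReal.toReal_nonneg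
    · simp only [ha, false_and, Set.ofPred_false, measureReal_empty]
      positivity
  have hsum : ∑ a : α, μ.real (U ⁻¹' {a}) = 1 := by
    rw [sum_measureReal_preimage_singleton Finset.univ fun a _ => hU (MeasurableSet.singleton a)]
    simp
  calc _ ≤ ∑ a : α, μ.real {ω | a ∈ good ∧ U ω = a ∧ V ω ∈ S a} :=
        (measureReal_mono hsub).trans (measureReal_iUnion_fintype_le _)
    _ ≤ ∑ a : α, μ.real (U ⁻¹' {a}) * ε := Finset.sum_le_sum fun a _ => hterm a
    _ = ε := by rw [← Finset.sum_mul, hsum, one_mul]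

/-! ### The noise of the comparisons for a fixed comparison graph -/

section frequencies

variable {n T L : ℕ}

lemma nbhdPair_symm (g : Fin (T + 1) → SimpleGraph (Fin n)) (δ t : ℝ) (i j : Fin n) :
    nbhdPair g δ t i j = nbhdPair g δ t j i := by
  ext k
  simp only [nbhdPair, Finset.mem_filter, (g k).adj_comm i j]

lemma gridTime_mem_Icc (hT : 1 ≤ T) (k : Fin (T + 1)) : gridTime T k ∈ Set.Icc (0 : ℝ) 1 := by
  have hT' : (0 : ℝ) < T := by exact_mod_cast hT
  refine ⟨by unfold gridTime; positivity, ?_⟩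
  rw [gridTime, div_le_one hT']
  exact_mod_cast Nat.lt_succ_iff.1 k.2

/-- The average of the winning probabilities over the times at which `i` and `j` are compared. -/
noncomputable def avgWinProb (w : ℝ → Fin n → ℝ) (g : Fin (T + 1) → SimpleGraph (Fin n))
    (δ t : ℝ) (i j : Fin n) : ℝ :=
  (∑ k ∈ nbhdPair g δ t i j, winProb w (gridTime T k) i j) / ((nbhdPair g δ t i j).card : ℝ)

/-- The deviation of the winning frequencies from the winning probabilities. -/
noncomputable def noise (w : ℝ → Fin n → ℝ) (g : Fin (T + 1) → SimpleGraph (Fin n))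
    (y : Fin (T + 1) → Fin n → Fin n → Fin L → Bool) (δ t : ℝ) (i j : Fin n) : ℝ :=
  if i = j then 0 else avgWinFreq g y δ t i j - avgWinProb w g δ t i j

variable {g : Fin (T + 1) → SimpleGraph (Fin n)}
  {y : Fin (T + 1) → Fin n → Fin n → Fin L → Bool} {δ t : ℝ} {w : ℝ → Fin n → ℝ} {i j : Fin n}

lemma winFreq_add_swap (hL : 1 ≤ L) (hy : ∀ k l, y k j i l = !(y k i j l)) (k : Fin (T + 1)) :
    winFreq y k i j + winFreq y k j i = 1 := by
  have hL' : (L : ℝ) ≠ 0 := by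
    have : L ≠ 0 := by omega
    exact_mod_cast this
  rw [winFreq, winFreq, ← add_div, ← Finset.sum_add_distrib, div_eq_one_iff_eq hL']
  have h : ∀ l, (if y k i j l then (1 : ℝ) else 0) + (if y k j i l then 1 else 0) = 1 := fun l => by
    rw [hy k l]
    cases y k i j l <;> simp
  simp [h]

lemma winProb_add_swap {s : ℝ} (hw : ∀ i, 0 < w s i) :
    winProb w s i j + winProb w s j i = 1 := by
  have h : w s i + w s j ≠ 0 := (add_pos (hw i) (hw j)).ne'
  rw [winProb, winProb, add_comm (w s j), ← add_div, add_comm (w s j), div_self h]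

lemma avgWinFreq_add_swap (hL : 1 ≤ L) (hy : ∀ k l, y k j i l = !(y k i j l))
    (hN : (nbhdPair g δ t i j).Nonempty) :
    avgWinFreq g y δ t i j + avgWinFreq g y δ t j i = 1 := by
  have hN' : ((nbhdPair g δ t i j).card : ℝ) ≠ 0 := by exact_mod_cast hN.card_pos.ne'
  rw [avgWinFreq, avgWinFreq, nbhdPair_symm g δ t j i, ← add_div, ← Finset.sum_add_distrib,
    div_eq_one_iff_eq hN']
  simp [winFreq_add_swap hL hy]

lemma avgWinProb_add_swap (hT : 1 ≤ T) (hw : ∀ s ∈ Set.Icc (0 : ℝ) 1, ∀ i, 0 < w s i)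
    (hN : (nbhdPair g δ t i j).Nonempty) :
    avgWinProb w g δ t i j + avgWinProb w g δ t j i = 1 := by
  have hN' : ((nbhdPair g δ t i j).card : ℝ) ≠ 0 := by exact_mod_cast hN.card_pos.ne'
  rw [avgWinProb, avgWinProb, nbhdPair_symm g δ t j i, ← add_div, ← Finset.sum_add_distrib,
    div_eq_one_iff_eq hN']
  simp [winProb_add_swap (hw _ (gridTime_mem_Icc hT _))]

lemma noise_swap (hT : 1 ≤ T) (hL : 1 ≤ L) (hw : ∀ s ∈ Set.Icc (0 : ℝ) 1, ∀ i, 0 < w s i)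
    (hij : i ≠ j) (hy : ∀ k l, y k j i l = !(y k i j l)) (hN : (nbhdPair g δ t i j).Nonempty) :
    noise w g y δ t j i = -noise w g y δ t i j := by
  rw [noise, noise, if_neg hij, if_neg hij.symm]
  linarith [avgWinFreq_add_swap (g := g) (δ := δ) (t := t) hL hy hN,
    avgWinProb_add_swap (g := g) (δ := δ) (t := t) hT hw hN]

lemma noise_eq_sum (hL : 1 ≤ L) (hij : i ≠ j) :
    noise w g y δ t i j = ∑ k ∈ nbhdPair g δ t i j, ∑ l : Fin L,
      1 / (L * ((nbhdPair g δ t i j).card : ℝ)) *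
        ((if y k i j l then (1 : ℝ) else 0) - winProb w (gridTime T k) i j) := by
  have hL' : (L : ℝ) ≠ 0 := by
    have : L ≠ 0 := by omega
    exact_mod_cast this
  rw [noise, if_neg hij, avgWinFreq, avgWinProb, ← sub_div, ← Finset.sum_sub_distrib,
    Finset.sum_div]
  refine Finset.sum_congr rfl fun k _ => ?_
  rw [← Finset.mul_sum, Finset.sum_sub_distrib, winFreq, Finset.sum_const, Finset.card_univ,
    Fintype.card_fin, nsmul_eq_mul]
  field_simp

end frequencies

lemma sum_sum_eq_sum_diag_add_sum_lt {ι : Type*} [Fintype ι] [LinearOrder ι] (F : ι → ι → ℝ) :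
    ∑ i, ∑ j, F i j = ∑ i, F i i +
      ∑ e : {e : ι × ι // e.1 < e.2}, (F e.1.1 e.1.2 + F e.1.2 e.1.1) := by
  have h1 : ∀ H : ι → ι → ℝ, ∑ e : {e : ι × ι // e.1 < e.2}, H e.1.1 e.1.2 =
      ∑ i, ∑ j, if i < j then H i j else 0 := fun H => by
    rw [← Finset.sum_subtype (Finset.univ.filter fun e : ι × ι => e.1 < e.2) (by simp)
      fun e => H e.1 e.2, Finset.sum_filter, Fintype.sum_prod_type]
  rw [Finset.sum_add_distrib, h1 F, h1 fun i j => F j i, Finset.sum_comm (γ := ι)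
    (f := fun i j => if i < j then F j i else 0), ← Finset.sum_add_distrib,
    ← Finset.sum_add_distrib]
  refine Finset.sum_congr rfl fun i _ => ?_
  have h2 : F i i = ∑ j, if i = j then F i j else 0 := by simp
  rw [h2, ← Finset.sum_add_distrib, ← Finset.sum_add_distrib]
  refine Finset.sum_congr rfl fun j _ => ?_
  rcases lt_trichotomy i j with h | h | h
  · simp [h, h.ne, h.not_gt]
  · simp [h]
  · simp [h, h.ne', h.not_gt]

lemma hasSubgaussianMGF_bernoulli [IsProbabilityMeasure μ] {B : Ω → Bool} (hB : Measurable B)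
    {q : ℝ} (hq : μ.real {ω | B ω = true} = q) :
    HasSubgaussianMGF (fun ω => (if B ω then (1 : ℝ) else 0) - q) (1 / 4) μ := by
  have hm : Measurable fun ω => if B ω then (1 : ℝ) else 0 :=
    (measurable_from_top (f := fun b : Bool => if b then (1 : ℝ) else 0)).comp hB
  have h := hasSubgaussianMGF_of_mem_Icc (μ := μ) (a := 0) (b := 1) hm.aemeasurable
    (ae_of_all _ fun ω => by cases B ω <;> simp)
  have hset : MeasurableSet {ω | B ω = true} := hB (MeasurableSet.singleton true)
  have hint : ∫ ω, (if B ω then (1 : ℝ) else 0) ∂μ = q := by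
    rw [← hq, ← integral_indicator_one hset]
    congr 1
    ext ω
    simp [Set.indicator_apply]
  rw [hint] at h
  convert h using 1
  ext
  norm_num

/-- The noise is antisymmetric, so a linear form in it is a sum over pairs `i < j` with coefficients
`c i j - c j i`, that is, a weighted sum of independent centered Bernoulli variables, each of proxy
`1 / 4`. A pair compared at `N` times contributes `(c i j - c j i) ^ 2 / (4 L N) ≤ (c i j ^ 2 + c j
i ^ 2) / (2 L m)`. -/
lemma isSubgaussianMatrix_noise [IsProbabilityMeasure μ] {n T L : ℕ} {w : ℝ → Fin n → ℝ}
    {p : Fin (T + 1) → unitInterval} {G : Fin (T + 1) → Ω → SimpleGraph (Fin n)}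
    {Y : Fin (T + 1) → Fin n → Fin n → Fin L → Ω → Bool} (hT : 1 ≤ T) (hL : 1 ≤ L)
    (hw : ∀ s ∈ Set.Icc (0 : ℝ) 1, ∀ i, 0 < w s i) (hdata : IsDynamicBTLData μ w p G Y)
    {g : Fin (T + 1) → SimpleGraph (Fin n)} {δ t : ℝ} {m : ℝ≥0} (hm : 0 < m)
    (hg : ∀ i j, i ≠ j → (m : ℝ) ≤ (nbhdPair g δ t i j).card) :
    IsSubgaussianMatrix (fun ω => noise w g (fun k i j l => Y k i j l ω) δ t)
      ((2 * L * m)⁻¹) μ := by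
  classical
  have hL' : (0 : ℝ) < L := by exact_mod_cast hL
  have hL'' : (0 : ℝ≥0) < L := by exact_mod_cast hL
  have hm' : (0 : ℝ) < m := hm
  have hpos : ∀ i j, i ≠ j → (0 : ℝ) < (nbhdPair g δ t i j).card := fun i j hij =>
    hm'.trans_le (hg i j hij)
  have hne : ∀ i j, i ≠ j → (nbhdPair g δ t i j).Nonempty := fun i j hij =>
    Finset.card_pos.1 (by exact_mod_cast hpos i j hij)
  have hind : ∀ k i j l, Measurable fun ω => if Y k i j l ω then (1 : ℝ) else 0 := fun k i j l =>
    (measurable_from_top (f := fun b : Bool => if b then (1 : ℝ) else 0)).comp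
      (hdata.measurable_outcome k i j l)
  constructor
  · refine measurable_pi_lambda _ fun i => measurable_pi_lambda _ fun j => ?_
    by_cases hij : i = j
    · simp only [noise, hij, if_true]
      exact measurable_const
    · simp only [noise_eq_sum hL hij]
      exact Finset.measurable_sum _ fun k _ => Finset.measurable_sum _ fun l _ =>
        ((hind k i j l).sub_const _).const_mul _
  intro c
  set I := Fin (T + 1) × {e : Fin n × Fin n // e.1 < e.2} × Fin L
  set r : {e : Fin n × Fin n // e.1 < e.2} → ℝ := fun e =>
    (c e.1.1 e.1.2 - c e.1.2 e.1.1) / (L * (nbhdPair g δ t e.1.1 e.1.2).card)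
  set a : I → ℝ := fun x => if x.1 ∈ nbhdPair g δ t x.2.1.1.1 x.2.1.1.2 then r x.2.1 else 0
  set Z : I → Ω → ℝ := fun x ω => (if Y x.1 x.2.1.1.1 x.2.1.1.2 x.2.2 ω then (1 : ℝ) else 0) -
    winProb w (gridTime T x.1) x.2.1.1.1 x.2.1.1.2
  have hsumI : ∀ (f : I → ℝ), ∑ x, f x = ∑ e, ∑ k, ∑ l, f (k, e, l) := fun f => by
    rw [Fintype.sum_prod_type]
    simp only [Fintype.sum_prod_type]
    exact Finset.sum_comm
  have hite : ∀ (e : {e : Fin n × Fin n // e.1 < e.2}) (h : Fin (T + 1) → Fin L → ℝ),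
      ∑ k, ∑ l, (if k ∈ nbhdPair g δ t e.1.1 e.1.2 then h k l else 0) =
        ∑ k ∈ nbhdPair g δ t e.1.1 e.1.2, ∑ l, h k l := fun e h => by
    have h1 : ∀ k, ∑ l, (if k ∈ nbhdPair g δ t e.1.1 e.1.2 then h k l else 0) =
        if k ∈ nbhdPair g δ t e.1.1 e.1.2 then ∑ l, h k l else 0 := fun k => by
      split_ifs <;> simp
    simp only [h1]
    rw [Finset.sum_ite_mem, Finset.univ_inter]
  have hlin : ∀ ω, ∑ i, ∑ j, c i j * noise w g (fun k i j l => Y k i j l ω) δ t i j =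
      ∑ x, a x * Z x ω := fun ω => by
    rw [sum_sum_eq_sum_diag_add_sum_lt, hsumI]
    have h0 : ∑ i, c i i * noise w g (fun k i j l => Y k i j l ω) δ t i i = 0 :=
      Finset.sum_eq_zero fun i _ => by simp [noise]
    rw [h0, zero_add]
    refine Finset.sum_congr rfl fun e _ => ?_
    have he : e.1.1 ≠ e.1.2 := e.2.ne
    rw [noise_swap hT hL hw he (fun k l => hdata.swap_outcome k _ _ l ω he) (hne _ _ he),
      mul_neg, ← sub_eq_add_neg, ← sub_mul, noise_eq_sum hL he, Finset.mul_sum]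
    simp only [a, Z, ite_mul, zero_mul]
    rw [hite]
    refine Finset.sum_congr rfl fun k _ => ?_
    rw [Finset.mul_sum]
    refine Finset.sum_congr rfl fun l _ => ?_
    simp only [r]
    ring
  have hsub : HasSubgaussianMGF (fun ω => ∑ x, a x * Z x ω)
      (∑ x, ⟨a x ^ 2, sq_nonneg _⟩ * (1 / 4)) μ := by
    refine HasSubgaussianMGF.sum_of_iIndepFun (s := Finset.univ) (X := fun x ω => a x * Z x ω)
      ?_ fun x _ => ?_
    · exact hdata.indep_outcome.comp (fun x b => a x * ((if b then (1 : ℝ) else 0) -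
        winProb w (gridTime T x.1) x.2.1.1.1 x.2.1.1.2)) fun x => measurable_from_top
    · exact (hasSubgaussianMGF_bernoulli (hdata.measurable_outcome _ _ _ _)
        (hdata.law_outcome _ _ _ _ x.2.1.2.ne)).const_mul (a x)
  simp only [hlin]
  refine HasSubgaussianMGF_mono hsub ?_
  rw [← NNReal.coe_le_coe]
  push_cast
  rw [Real.coe_toNNReal _ (Finset.sum_nonneg fun _ _ => Finset.sum_nonneg fun _ _ => sq_nonneg _)]
  have hterm : ∀ e : {e : Fin n × Fin n // e.1 < e.2}, ∑ k, ∑ l : Fin L, a (k, e, l) ^ 2 * (1 / 4) ≤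
      (2 * L * (m : ℝ))⁻¹ * (c e.1.1 e.1.2 ^ 2 + c e.1.2 e.1.1 ^ 2) := fun e => by
    have hN := hpos e.1.1 e.1.2 e.2.ne
    simp only [a, ite_pow, ite_mul, zero_pow two_ne_zero, zero_mul]
    rw [hite]
    simp only [Finset.sum_const, Finset.card_univ, Fintype.card_fin, nsmul_eq_mul, r]
    have h2 : (c e.1.1 e.1.2 - c e.1.2 e.1.1) ^ 2 ≤
        2 * (c e.1.1 e.1.2 ^ 2 + c e.1.2 e.1.1 ^ 2) := by
      nlinarith [sq_nonneg (c e.1.1 e.1.2 + c e.1.2 e.1.1)]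
    calc _ = (4 * L * ((nbhdPair g δ t e.1.1 e.1.2).card : ℝ))⁻¹ *
          (c e.1.1 e.1.2 - c e.1.2 e.1.1) ^ 2 := by field_simp
      _ ≤ (4 * L * (m : ℝ))⁻¹ * (2 * (c e.1.1 e.1.2 ^ 2 + c e.1.2 e.1.1 ^ 2)) := by
        gcongr
        exact hg _ _ e.2.ne
      _ = _ := by
        field_simp
        norm_num
  have hdiag : 0 ≤ ∑ i, c i i ^ 2 := Finset.sum_nonneg fun _ _ => sq_nonneg _
  calc _ = ∑ x, a x ^ 2 * (1 / 4) := rfl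
    _ = ∑ e, ∑ k, ∑ l : Fin L, a (k, e, l) ^ 2 * (1 / 4) := hsumI fun x => a x ^ 2 * (1 / 4)
    _ ≤ ∑ e : {e : Fin n × Fin n // e.1 < e.2},
        (2 * L * (m : ℝ))⁻¹ * (c e.1.1 e.1.2 ^ 2 + c e.1.2 e.1.1 ^ 2) :=
      Finset.sum_le_sum fun e _ => hterm e
    _ ≤ _ := by
      rw [sum_sum_eq_sum_diag_add_sum_lt, ← Finset.mul_sum]
      gcongr
      linarith

/-! ### The empirical transition matrix -/

section transMatrix

variable {n T L : ℕ} {g : Fin (T + 1) → SimpleGraph (Fin n)}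
  {y : Fin (T + 1) → Fin n → Fin n → Fin L → Bool} {δ t d : ℝ}

lemma avgWinFreq_nonneg (i j : Fin n) : 0 ≤ avgWinFreq g y δ t i j := by
  unfold avgWinFreq winFreq
  refine div_nonneg (Finset.sum_nonneg fun k _ => div_nonneg (Finset.sum_nonneg fun l _ => ?_)
    (Nat.cast_nonneg _)) (Nat.cast_nonneg _)
  split_ifs <;> norm_num

lemma avgWinFreq_le_one (i j : Fin n) : avgWinFreq g y δ t i j ≤ 1 := by
  unfold avgWinFreq
  refine div_le_one_of_le₀ ?_ (Nat.cast_nonneg _)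
  have h : ∀ k ∈ nbhdPair g δ t i j, winFreq y k i j ≤ 1 := fun k _ => by
    unfold winFreq
    refine div_le_one_of_le₀ ?_ (Nat.cast_nonneg _)
    refine (Finset.sum_le_card_nsmul _ _ 1 fun l _ => ?_).trans (by simp)
    split_ifs <;> norm_num
  exact (Finset.sum_le_card_nsmul _ _ 1 h).trans (by simp)

lemma avgWinFreq_congr {y' : Fin (T + 1) → Fin n → Fin n → Fin L → Bool} {i j : Fin n}
    (h : ∀ k l, y k i j l = y' k i j l) : avgWinFreq g y δ t i j = avgWinFreq g y' δ t i j := by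
  simp only [avgWinFreq, winFreq, h]

lemma transMatrix_congr {y' : Fin (T + 1) → Fin n → Fin n → Fin L → Bool}
    (h : ∀ k i j l, i ≠ j → y k i j l = y' k i j l) :
    transMatrix g y δ t d = transMatrix g y' δ t d := by
  have h1 : ∀ i j, i ≠ j → avgWinFreq g y δ t i j = avgWinFreq g y' δ t i j := fun i j hij =>
    avgWinFreq_congr fun k l => h k i j l hij
  ext i j
  simp only [transMatrix, Matrix.of_apply]
  by_cases hij : i = j
  · simp only [hij, if_true]
    congr 2
    exact Finset.sum_congr rfl fun k hk => h1 _ _ (Finset.ne_of_mem_erase hk).symm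
  · simp only [if_neg hij, h1 i j hij]

lemma transMatrix_apply_of_ne {i j : Fin n} (hij : i ≠ j) :
    transMatrix g y δ t d i j = avgWinFreq g y δ t i j / d := by
  simp only [transMatrix, Matrix.of_apply, if_neg hij]
  split_ifs with h
  · rfl
  -- For a non-edge of the union graph the average is an empty sum over `0`, so its default value
  -- agrees with the case split.
  · have hN : nbhdPair g δ t i j = ∅ := by
      rw [Finset.eq_empty_iff_forall_notMem]
      intro k hk
      refine h ?_
      simp only [nbhdPair, Finset.mem_filter] at hk
      simp only [unionGraph, SimpleGraph.iSup_adj]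
      exact ⟨k, hk.1, hk.2⟩
    simp [avgWinFreq, hN]

lemma transMatrix_apply_self (i : Fin n) :
    transMatrix g y δ t d i i = 1 - (∑ k ∈ Finset.univ.erase i, avgWinFreq g y δ t i k) / d := by
  simp [transMatrix]

lemma transMatrix_mem_rowStochastic (hd : 0 < d) (hnd : n ≤ d) :
    transMatrix g y δ t d ∈ Matrix.rowStochastic ℝ (Fin n) := by
  rw [Matrix.mem_rowStochastic_iff_sum]
  refine ⟨fun i j => ?_, fun i => ?_⟩
  · by_cases hij : i = j
    · rw [← hij, transMatrix_apply_self, sub_nonneg, div_le_one hd]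
      refine ((Finset.sum_le_card_nsmul _ _ 1 fun k _ => avgWinFreq_le_one i k).trans ?_).trans hnd
      rw [nsmul_eq_mul, mul_one]
      exact_mod_cast (Finset.card_le_univ _).trans (by simp)
    · rw [transMatrix_apply_of_ne hij]
      exact div_nonneg (avgWinFreq_nonneg i j) hd.le
  · rw [← Finset.add_sum_erase _ _ (Finset.mem_univ i), transMatrix_apply_self, Finset.sum_div,
      sub_add_eq_add_sub, sub_eq_iff_eq_add]
    congr 1
    exact Finset.sum_congr rfl fun j hj =>
      transMatrix_apply_of_ne (Finset.ne_of_mem_erase hj).symm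

lemma vecMul_transMatrix {A : Fin n → Fin n → ℝ}
    (hA : ∀ i j, i ≠ j → A i j = avgWinFreq g y δ t i j) (x : Fin n → ℝ) :
    x ᵥ* transMatrix g y δ t d = x + d⁻¹ • flow A x := by
  ext j
  change ∑ i, x i * transMatrix g y δ t d i j = x j + d⁻¹ * flow A x j
  rw [← Finset.add_sum_erase _ _ (Finset.mem_univ j), transMatrix_apply_self, flow,
    ← Finset.add_sum_erase _ (fun i => x i * A i j - x j * A j i) (Finset.mem_univ j), sub_self,
    zero_add, Finset.sum_sub_distrib, ← Finset.mul_sum]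
  have h1 : ∑ i ∈ Finset.univ.erase j, x i * transMatrix g y δ t d i j =
      d⁻¹ * ∑ i ∈ Finset.univ.erase j, x i * A i j := by
    rw [Finset.mul_sum]
    refine Finset.sum_congr rfl fun i hi => ?_
    rw [transMatrix_apply_of_ne (Finset.ne_of_mem_erase hi), hA i j (Finset.ne_of_mem_erase hi)]
    ring
  have h2 : ∑ i ∈ Finset.univ.erase j, A j i =
      ∑ i ∈ Finset.univ.erase j, avgWinFreq g y δ t j i :=
    Finset.sum_congr rfl fun i hi => hA j i (Finset.ne_of_mem_erase hi).symm
  rw [h1, h2]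
  ring

end transMatrix

/-! ### Normalized weights -/

section weights

variable {n : ℕ} {w : ℝ → Fin n → ℝ} {t : ℝ}

lemma sum_weight_pos (hn : 0 < n) (hw : ∀ i, 0 < w t i) : 0 < ∑ i, w t i :=
  Finset.sum_pos (fun i _ => hw i) ⟨⟨0, hn⟩, Finset.mem_univ _⟩

lemma piStar_pos (hn : 0 < n) (hw : ∀ i, 0 < w t i) (i : Fin n) : 0 < piStar w t i :=
  div_pos (hw i) (sum_weight_pos hn hw)

lemma sum_piStar (hn : 0 < n) (hw : ∀ i, 0 < w t i) : ∑ i, piStar w t i = 1 := by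
  simp only [piStar]
  rw [← Finset.sum_div, div_self (sum_weight_pos hn hw).ne']

lemma weight_div_le_maxRatio (i j : Fin n) : w t i / w t j ≤ maxRatio w t :=
  le_ciSup (f := fun e : Fin n × Fin n => w t e.1 / w t e.2) (Set.finite_range _).bddAbove (i, j)

lemma one_le_maxRatio (hn : 0 < n) (hw : ∀ i, 0 < w t i) : 1 ≤ maxRatio w t := by
  have h := weight_div_le_maxRatio (w := w) (t := t) ⟨0, hn⟩ ⟨0, hn⟩
  rwa [div_self (hw _).ne'] at h

lemma piStar_le_mul (hn : 0 < n) (hw : ∀ i, 0 < w t i) (i j : Fin n) :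
    piStar w t i ≤ maxRatio w t * piStar w t j := by
  have h := (div_le_iff₀ (hw j)).1 (weight_div_le_maxRatio (w := w) (t := t) i j)
  rw [piStar, piStar, ← mul_div_assoc]
  have := sum_weight_pos hn hw
  gcongr

lemma btlRate_piStar (hn : 0 < n) (hw : ∀ i, 0 < w t i) (i j : Fin n) :
    btlRate (piStar w t) i j = winProb w t i j := by
  have := (sum_weight_pos hn hw).ne'
  rw [btlRate, winProb, piStar, piStar, ← add_div, div_div_div_cancel_right₀ this]

end weights

/-! ### Bias and deterministic error bound -/

/-- The bias is at most the smoothness constant times the bandwidth. -/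
lemma abs_avgWinProb_sub_le {n T : ℕ} {w : ℝ → Fin n → ℝ} {M δ t : ℝ} (hM : 0 ≤ M)
    (hLip : LipschitzOutcomes w M) (hT : 1 ≤ T) (ht : t ∈ Set.Icc (0 : ℝ) 1)
    {g : Fin (T + 1) → SimpleGraph (Fin n)} {i j : Fin n} (hij : i ≠ j)
    (hN : (nbhdPair g δ t i j).Nonempty) :
    |avgWinProb w g δ t i j - winProb w t i j| ≤ M * δ / T := by
  have hN' : (0 : ℝ) < (nbhdPair g δ t i j).card := by exact_mod_cast hN.card_pos
  have h1 : avgWinProb w g δ t i j - winProb w t i j =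
      (∑ k ∈ nbhdPair g δ t i j, (winProb w (gridTime T k) i j - winProb w t i j)) /
        (nbhdPair g δ t i j).card := by
    rw [avgWinProb, Finset.sum_sub_distrib, Finset.sum_const, nsmul_eq_mul]
    field_simp
  rw [h1, abs_div, abs_of_pos hN', div_le_iff₀ hN']
  refine (Finset.abs_sum_le_sum_abs _ _).trans ?_
  refine (Finset.sum_le_card_nsmul _ _ (M * δ / T) fun k hk => ?_).trans (le_of_eq ?_)
  · refine (hLip _ (gridTime_mem_Icc hT k) _ ht i j hij).trans ?_
    simp only [nbhdPair, nbhd, Finset.mem_filter, Finset.mem_univ, true_and] at hk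
    rw [abs_sub_comm, mul_div_assoc]
    exact mul_le_mul_of_nonneg_left hk.1 hM
  · rw [nsmul_eq_mul, mul_comm]

/-- Deterministic error bound of the spectral estimator in terms of the flow of the noise. -/
lemma exists_isLeadingLeftEigenvector_relErr_le {n T L : ℕ} {w : ℝ → Fin n → ℝ} {M δ t d : ℝ}
    (hn : 0 < n) (hT : 1 ≤ T) (hw : ∀ i, 0 < w t i) (hM : 0 ≤ M) (hLip : LipschitzOutcomes w M)
    (hδ : 0 ≤ δ) (ht : t ∈ Set.Icc (0 : ℝ) 1) (hd : n ≤ d)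
    {g : Fin (T + 1) → SimpleGraph (Fin n)} {y : Fin (T + 1) → Fin n → Fin n → Fin L → Bool}
    (hg : ∀ i j, i ≠ j → (nbhdPair g δ t i j).Nonempty) {ρ ρ' : ℝ}
    (hop : ∀ x, l2 (flow (noise w g y δ t) x) ≤ ρ * l2 x)
    (hvec : l2 (flow (noise w g y δ t) (piStar w t)) ≤ ρ')
    (hρ : 4 * maxRatio w t ^ 3 * (ρ + 2 * (M * δ / T) * n) ≤ n) :
    ∃ πhat, IsLeadingLeftEigenvector (transMatrix g y δ t d) πhat ∧
      relErr πhat (piStar w t) ≤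
        4 * maxRatio w t ^ 3 / n * (ρ' * √n) + 8 * maxRatio w t ^ 3 * (M * δ / T) := by
  have hn' : (0 : ℝ) < n := by exact_mod_cast hn
  have hd0 : 0 < d := hn'.trans_le hd
  have hb0 : 0 < maxRatio w t := one_pos.trans_le (one_le_maxRatio hn hw)
  set π := piStar w t
  set b := maxRatio w t
  set β := M * δ / T
  have hβ : 0 ≤ β := by simp only [β]; positivity
  have hπ : ∀ i, 0 < π i := piStar_pos hn hw
  have hsum : ∑ i, π i = 1 := sum_piStar hn hw
  have hb : ∀ i j, π i ≤ b * π j := piStar_le_mul hn hw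
  -- The diagonal has no influence on the flow. It is set to zero because the difference there would
  -- not be small: `winProb w t i i = 1 / 2`, while the average over no comparisons is `0`.
  set B : Fin n → Fin n → ℝ := fun i j =>
    if i = j then 0 else avgWinProb w g δ t i j - winProb w t i j
  have hB : ∀ i j, |B i j| ≤ β := fun i j => by
    simp only [B]
    split_ifs with hij
    · simpa using hβ
    · exact abs_avgWinProb_sub_le hM hLip hT ht hij (hg i j hij)
  set A : Fin n → Fin n → ℝ := noise w g y δ t + B + btlRate π
  have hA : ∀ i j, i ≠ j → A i j = avgWinFreq g y δ t i j := fun i j hij => by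
    simp only [A, B, Pi.add_apply, noise, if_neg hij, π, btlRate_piStar hn hw]
    ring
  have hAsub : A - btlRate π = noise w g y δ t + B := add_sub_cancel_right _ _
  have hBx : ∀ x, l2 (flow B x) ≤ 2 * β * n * l2 x := fun x => by
    simpa using l2_flow_le_of_abs_le hB x
  have hclose : ∀ x, l2 (flow (A - btlRate π) x) ≤ (ρ + 2 * β * n) * l2 x := fun x => by
    rw [hAsub, flow_add, add_mul]
    exact (l2_add_le _ _).trans (add_le_add (hop x) (hBx x))
  have hgap : ∀ {E : Fin n → ℝ}, ∑ i, E i = 0 → l2 E ≤ 4 * b ^ 3 / n * l2 (flow A E) := by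
    intro E hE
    simpa using l2_le_mul_l2_flow_of_close hπ hsum hb hclose (by simpa using hρ) hE
  have hstat : ∀ x, IsStationary (transMatrix g y δ t d) x → flow A x = 0 := fun x hx => by
    have h := hx.2
    rw [vecMul_transMatrix hA, add_eq_left] at h
    exact (smul_eq_zero.1 h).resolve_left (inv_ne_zero hd0.ne')
  have hP := transMatrix_mem_rowStochastic (g := g) (y := y) (δ := δ) (t := t) hd0 hd
  obtain ⟨πhat, hhat⟩ := exists_isStationary hn hP
  refine ⟨πhat, ⟨hP, hhat, fun π' hπ' => ?_⟩, ?_⟩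
  · have h0 : ∑ i, (π' - πhat) i = 0 := by
      simp only [Pi.sub_apply, Finset.sum_sub_distrib]
      rw [hπ'.1.2, hhat.1.2, sub_self]
    have h := hgap h0
    rw [flow_sub, hstat _ hπ', hstat _ hhat, sub_self, l2_eq_zero.2 rfl, mul_zero] at h
    exact sub_eq_zero.1 (l2_eq_zero.1 (le_antisymm h (l2_nonneg _)))
  · have h0 : ∑ i, (πhat - π) i = 0 := by
      simp only [Pi.sub_apply, Finset.sum_sub_distrib]
      rw [hhat.1.2, hsum, sub_self]
    have h := hgap h0
    have hflow : flow A π = flow (noise w g y δ t) π + flow B π := by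
      simp only [A, flow_add, flow_btlRate_self, add_zero]
    rw [flow_sub, hstat _ hhat, zero_sub, l2_neg, hflow] at h
    have h2 : l2 (flow (noise w g y δ t) π + flow B π) ≤ ρ' + 2 * β * n * l2 π :=
      (l2_add_le _ _).trans (add_le_add hvec (hBx π))
    -- Turns the absolute noise term into a relative one, at the price of `√n`; the bias term
    -- already carries the factor `l2 π`.
    have hπnorm : 1 ≤ √n * l2 π := by
      have h3 := sum_abs_le_sqrt_card_mul_l2 π
      rw [Fintype.card_fin] at h3
      refine le_trans (le_of_eq ?_) h3
      rw [← hsum]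
      exact Finset.sum_congr rfl fun i _ => (abs_of_pos (hπ i)).symm
    have hπ0 : 0 < l2 π := by
      by_contra! hcon
      have := le_antisymm hcon (l2_nonneg π)
      rw [this] at hπnorm
      linarith
    have hρ0 : 0 ≤ ρ' := (l2_nonneg _).trans hvec
    change l2 (πhat - π) / l2 π ≤ _
    rw [div_le_iff₀ hπ0]
    calc l2 (πhat - π) ≤ 4 * b ^ 3 / n * (ρ' + 2 * β * n * l2 π) := h.trans (by gcongr)
      _ = 4 * b ^ 3 / n * ρ' + 8 * b ^ 3 * β * l2 π := by
        field_simp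
        ring
      _ ≤ 4 * b ^ 3 / n * (ρ' * (√n * l2 π)) + 8 * b ^ 3 * β * l2 π := by
        gcongr
        exact le_mul_of_one_le_right hρ0 hπnorm
      _ = _ := by ring

/-! ### Outcomes of all ordered pairs -/

/-- The outcomes of all the comparisons, from those of the ordered pairs `i < j`. -/
def extendOutcome {n T L : ℕ} (z : Fin (T + 1) × {e : Fin n × Fin n // e.1 < e.2} × Fin L → Bool)
    (k : Fin (T + 1)) (i j : Fin n) (l : Fin L) : Bool :=
  if h : i < j then z (k, ⟨(i, j), h⟩, l) else if h : j < i then !z (k, ⟨(j, i), h⟩, l) else false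

lemma extendOutcome_eq {n T L : ℕ} {y : Fin (T + 1) → Fin n → Fin n → Fin L → Bool}
    (hy : ∀ k i j l, i ≠ j → y k j i l = !y k i j l) {k : Fin (T + 1)} {i j : Fin n} (l : Fin L)
    (hij : i ≠ j) :
    extendOutcome (fun x => y x.1 x.2.1.1.1 x.2.1.1.2 x.2.2) k i j l = y k i j l := by
  rcases hij.lt_or_gt with h | h
  · simp [extendOutcome, h]
  · simp [extendOutcome, h, h.not_gt, hy k i j l hij]

/-- The spectral estimator is well defined and within the distance `ε` of the weights. -/
def EstimatorWithin {n T L : ℕ} (w : ℝ → Fin n → ℝ) (g : Fin (T + 1) → SimpleGraph (Fin n))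
    (y : Fin (T + 1) → Fin n → Fin n → Fin L → Bool) (δ t d ε : ℝ) : Prop :=
  ∃ πhat : Fin n → ℝ, IsLeadingLeftEigenvector (transMatrix g y δ t d) πhat ∧
    relErr πhat (piStar w t) ≤ ε

/-! ### Scalar inequalities and the error bound for fixed graphs -/

/-- Ensures `n ≤ 3 * n * pUnion p δ t`, the normalization under which the empirical matrix is
row-stochastic. -/
lemma half_le_pUnion {T : ℕ} {p : Fin (T + 1) → unitInterval} {δ t : ℝ} (h : 1 ≤ pSum p δ t) :
    1 / 2 ≤ pUnion p δ t := by
  have h1 : ∏ k ∈ nbhd T δ t, (1 - (p k : ℝ)) ≤ Real.exp (-pSum p δ t) := by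
    rw [pSum, ← Finset.sum_neg_distrib, Real.exp_sum]
    refine Finset.prod_le_prod (fun k _ => by linarith [(p k).2.2]) fun k _ => ?_
    linarith [Real.add_one_le_exp (-(p k : ℝ))]
  have h2 : Real.exp (-pSum p δ t) ≤ 1 / 2 := by
    rw [Real.exp_neg, inv_le_comm₀ (Real.exp_pos _) (by norm_num)]
    linarith [Real.add_one_le_exp (pSum p δ t)]
  rw [pUnion]
  linarith

lemma pUnion_le_one {T : ℕ} {p : Fin (T + 1) → unitInterval} {δ t : ℝ} : pUnion p δ t ≤ 1 := by
  have h1 : 0 ≤ ∏ k ∈ nbhd T δ t, (1 - (p k : ℝ)) :=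
    Finset.prod_nonneg fun k _ => by linarith [(p k).2.2]
  rw [pUnion]
  linarith

lemma pow_three_le_rpow {b : ℝ} (hb : 1 ≤ b) : b ^ 3 ≤ b ^ (7 / 2 : ℝ) := by
  rw [← Real.rpow_natCast]
  exact Real.rpow_le_rpow_of_exponent_le hb (by norm_num)

lemma pow_four_le_rpow {b : ℝ} (hb : 1 ≤ b) : b ^ 4 ≤ b ^ (9 / 2 : ℝ) := by
  rw [← Real.rpow_natCast]
  exact Real.rpow_le_rpow_of_exponent_le hb (by norm_num)

/-- The smallness condition on the noise and the bias implies that the perturbation is below the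
spectral gap. -/
lemma perturbation_le {N ℓ L q S b β : ℝ} (hN : 1 ≤ N) (hℓ : 0 ≤ ℓ) (hL : 0 < L) (hq : 0 < q)
    (hq1 : q ≤ 1) (hS : 0 < S) (hb : 1 ≤ b) (hβ : 0 ≤ β)
    (h : 2 * 15 * √(ℓ / (L * N * q * S)) + 16 * (β * N) ≤ 1 / (96 * b ^ (7 / 2 : ℝ))) :
    4 * b ^ 3 * (33 * √((2 / (L * S)) * (N * ℓ)) + 2 * β * N) ≤ N := by
  set r := √(ℓ / (L * N * q * S))
  have hr : 0 ≤ r := Real.sqrt_nonneg _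
  have hN0 : 0 < N := by linarith
  have h1 : √((2 / (L * S)) * (N * ℓ)) ≤ 2 * N * r := by
    refine Real.sqrt_le_iff.2 ⟨by positivity, ?_⟩
    rw [mul_pow, Real.sq_sqrt (by positivity)]
    have h2 : (2 * N) ^ 2 * (ℓ / (L * N * q * S)) = 4 * (ℓ * N / (L * S)) / q := by
      field_simp
      ring
    have h3 : 2 / (L * S) * (N * ℓ) = 2 * (ℓ * N / (L * S)) := by ring
    have h4 : 0 ≤ ℓ * N / (L * S) := by positivity
    rw [h2, h3, le_div_iff₀ hq]
    nlinarith
  have hb3 : 0 < b ^ 3 := by positivity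
  have h5 : b ^ 3 * (30 * r + 16 * (β * N)) ≤ 1 / 96 := by
    have hb7 : 0 < b ^ (7 / 2 : ℝ) := by positivity
    rw [le_div_iff₀ (by positivity)] at h
    have h6 : 0 ≤ 30 * r + 16 * (β * N) := by positivity
    nlinarith [mul_le_mul_of_nonneg_right (pow_three_le_rpow hb) h6]
  have h7 : β ≤ β * N := le_mul_of_one_le_right hβ hN
  -- The coefficient of `r` is `4 * 33 * 2 = 264 ≤ 9 * 30`, and `9 / 96 ≤ 1`.
  calc _ ≤ 4 * b ^ 3 * (33 * (2 * N * r) + 2 * (β * N) * N) := by gcongr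
    _ = N * (b ^ 3 * (264 * r + 8 * (β * N))) := by ring
    _ ≤ N * (9 * (b ^ 3 * (30 * r + 16 * (β * N)))) := by
      refine mul_le_mul_of_nonneg_left ?_ hN0.le
      have : 0 ≤ b ^ 3 * r := by positivity
      have : 0 ≤ b ^ 3 * (β * N) := by positivity
      nlinarith
    _ ≤ N := by nlinarith

/-- The proof yields the stronger rates `24 b ^ 4` and `8 b ^ 3 β`. Since `q ≤ 1`, dividing by `q`
under the root only enlarges the right side. -/
lemma error_le {N L q S b β : ℝ} (hN : 1 ≤ N) (hL : 0 < L) (hq : 0 < q)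
    (hq1 : q ≤ 1) (hS : 0 < S) (hb : 1 ≤ b) (hβ : 0 ≤ β) :
    4 * b ^ 3 / N * (6 * √(2 / (L * S)) * (b / N) * N * √N) + 8 * b ^ 3 * β ≤
      1536 * (β * N * b ^ (7 / 2 : ℝ)) + 64 * 1 * b ^ (9 / 2 : ℝ) * √(3 / (L * N * q * S)) := by
  have hN0 : 0 < N := by linarith
  have h1 : √(2 / (L * S)) * √N ≤ N * √(3 / (L * N * q * S)) := by
    rw [← Real.sqrt_mul (by positivity)]
    refine Real.sqrt_le_iff.2 ⟨by positivity, ?_⟩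
    rw [mul_pow, Real.sq_sqrt (by positivity)]
    have h2 : N ^ 2 * (3 / (L * N * q * S)) = 3 * (N / (L * S)) / q := by field_simp
    have h3 : 2 / (L * S) * N = 2 * (N / (L * S)) := by ring
    have h4 : 0 ≤ N / (L * S) := by positivity
    rw [h2, h3, le_div_iff₀ hq]
    nlinarith
  have h7 : β ≤ β * N := le_mul_of_one_le_right hβ hN
  have h8 : 0 ≤ √(3 / (L * N * q * S)) := Real.sqrt_nonneg _
  have hvar : 4 * b ^ 3 / N * (6 * √(2 / (L * S)) * (b / N) * N * √N) ≤
      64 * 1 * b ^ (9 / 2 : ℝ) * √(3 / (L * N * q * S)) :=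
    calc _ = 24 * b ^ 4 / N * (√(2 / (L * S)) * √N) := by
          field_simp
          ring
      _ ≤ 24 * b ^ 4 / N * (N * √(3 / (L * N * q * S))) := by gcongr
      _ = 24 * b ^ 4 * √(3 / (L * N * q * S)) := by field_simp
      _ ≤ 64 * 1 * b ^ (9 / 2 : ℝ) * √(3 / (L * N * q * S)) := by
        gcongr
        · norm_num
        · exact pow_four_le_rpow hb
  have hbias : 8 * b ^ 3 * β ≤ 1536 * (β * N * b ^ (7 / 2 : ℝ)) :=
    calc _ ≤ 1536 * b ^ (7 / 2 : ℝ) * (β * N) := by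
          gcongr
          · norm_num
          · exact pow_three_le_rpow hb
      _ = _ := by ring
  linarith

/-- Error bound for a fixed sequence of comparison graphs in which every pair is compared often. -/
lemma measureReal_not_estimatorWithin_le [IsProbabilityMeasure μ] {n T L : ℕ} {w : ℝ → Fin n → ℝ}
    {M : ℝ} {p : Fin (T + 1) → unitInterval} {G : Fin (T + 1) → Ω → SimpleGraph (Fin n)}
    {Y : Fin (T + 1) → Fin n → Fin n → Fin L → Ω → Bool} {t δ : ℝ} (hn : 2 ≤ n) (hT : 1 ≤ T)
    (hL : 1 ≤ L) (hw : ∀ s ∈ Set.Icc (0 : ℝ) 1, ∀ i, 0 < w s i) (hM : 0 ≤ M)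
    (hLip : LipschitzOutcomes w M) (hdata : IsDynamicBTLData μ w p G Y)
    (ht : t ∈ Set.Icc (0 : ℝ) 1) (hδ : 0 ≤ δ) (hlog : 10 * Real.log n ≤ n)
    (hS : 1 ≤ pSum p δ t)
    (hsmall : 2 * 15 * √(Real.log n / (L * n * pUnion p δ t * pSum p δ t)) +
      16 * (M * δ * n / T) ≤ 1 / (96 * maxRatio w t ^ (7 / 2 : ℝ)))
    {g : Fin (T + 1) → SimpleGraph (Fin n)}
    (hg : ∀ i j, i ≠ j → pSum p δ t / 4 ≤ (nbhdPair g δ t i j).card) :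
    μ.real {ω | ¬EstimatorWithin w g (fun k i j l => Y k i j l ω) δ t (3 * n * pUnion p δ t)
      (1536 * (M * δ * n * maxRatio w t ^ (7 / 2 : ℝ) / T) +
        64 * 1 * maxRatio w t ^ (9 / 2 : ℝ) * √(3 / (L * n * pUnion p δ t * pSum p δ t)))} ≤
      4 / (n : ℝ) ^ 10 := by
  have hn0 : 0 < n := by omega
  have hn1 : (1 : ℝ) ≤ n := by exact_mod_cast hn0
  have hn' : (0 : ℝ) < n := by linarith
  have hL' : (0 : ℝ) < L := by exact_mod_cast hL
  have hT' : (0 : ℝ) < T := by exact_mod_cast hT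
  have hwt := hw t ht
  have hb := one_le_maxRatio hn0 hwt
  have hS0 : 0 < pSum p δ t := by linarith
  have hq := half_le_pUnion hS
  have hq1 : pUnion p δ t ≤ 1 := pUnion_le_one
  set S := pSum p δ t
  set q := pUnion p δ t
  set b := maxRatio w t
  -- The guaranteed number of comparison times per pair; the proxy `1 / (2 L m)` becomes `2 / (L
  -- S)`.
  set m : ℝ≥0 := ⟨S / 4, by positivity⟩
  have hm : 0 < m := by
    rw [← NNReal.coe_pos]
    change 0 < S / 4
    positivity
  have hX := isSubgaussianMatrix_noise (δ := δ) (t := t) hT hL hw hdata hm hg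
  have hs : (((2 * L * m)⁻¹ : ℝ≥0) : ℝ) = 2 / (L * S) := by
    push_cast
    change (2 * L * (S / 4))⁻¹ = 2 / (L * S)
    field_simp
    norm_num
  have hbound := hX.measureReal_flow_bounds (x := piStar w t) (m := b / n) (by positivity)
    (by simpa using hn) (by simpa using hlog) (by positivity) (fun i => by
      rw [abs_of_pos (piStar_pos hn0 hwt i)]
      simpa using le_div_card_of_le_mul (sum_piStar hn0 hwt) (piStar_le_mul hn0 hwt) i)
  rw [hs, Fintype.card_fin] at hbound
  refine (measureReal_mono ?_).trans hbound
  intro ω hω hcon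
  refine hω ?_
  have hne : ∀ i j, i ≠ j → (nbhdPair g δ t i j).Nonempty := fun i j hij => by
    have h : (0 : ℝ) < (nbhdPair g δ t i j).card :=
      (by positivity : 0 < S / 4).trans_le (hg i j hij)
    exact Finset.card_pos.1 (by exact_mod_cast h)
  have hβ : 0 ≤ M * δ / T := by positivity
  have hβ1 : M * δ * n / T = M * δ / T * n := by ring
  have hβ2 : M * δ * n * b ^ (7 / 2 : ℝ) / T = M * δ / T * n * b ^ (7 / 2 : ℝ) := by ring
  rw [hβ1] at hsmall
  obtain ⟨πhat, h1, h2⟩ := exists_isLeadingLeftEigenvector_relErr_le (d := 3 * n * q) hn0 hT hwt hM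
    hLip hδ ht (by nlinarith) hne hcon.1 hcon.2
    (perturbation_le hn1 (Real.log_nonneg hn1) hL' (by linarith) hq1 hS0 hb hβ hsmall)
  refine ⟨πhat, h1, h2.trans ?_⟩
  rw [hβ2]
  exact error_le hn1 hL' (by linarith) hq1 hS0 hb hβ

end DynamicBTL

/-! ### Conditioning on the graphs and the final union bound -/

theorem theorem2 :
    ∃ c₀ c₁ c₂ C₁ C₂ K : ℝ,
      1 ≤ c₀ ∧ 0 < c₁ ∧ 1 ≤ c₂ ∧ 15 ≤ C₁ ∧ 1 ≤ C₂ ∧ 0 < K ∧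
      ∀ {Ω : Type*} [MeasurableSpace Ω] (μ : Measure Ω) [IsProbabilityMeasure μ]
        (n T L : ℕ) (w : ℝ → Fin n → ℝ) (M : ℝ) (p : Fin (T + 1) → unitInterval)
        (G : Fin (T + 1) → Ω → SimpleGraph (Fin n))
        (Y : Fin (T + 1) → Fin n → Fin n → Fin L → Ω → Bool)
        (t δ : ℝ),
        1 ≤ n → 1 ≤ T → 1 ≤ L →
        (∀ s ∈ Set.Icc (0 : ℝ) 1, ∀ i, 0 < w s i) →
        0 ≤ M → LipschitzOutcomes w M →
        IsDynamicBTLData μ w p G Y →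
        t ∈ Set.Icc (0 : ℝ) 1 → δ ∈ Set.Icc (1 / 2 : ℝ) T →
        c₁ * Real.log n ≤ n →
        c₀ * Real.log n ≤ n * pUnion p δ t →
        c₂ * Real.log n ≤ pSum p δ t →
        2 * C₁ * √(Real.log n / (L * n * pUnion p δ t * pSum p δ t)) + 16 * (M * δ * n / T)
          ≤ 1 / (96 * maxRatio w t ^ (7 / 2 : ℝ)) →
        1 - K / (n : ℝ) ^ 10 ≤
          μ.real {ω | ∃ πhat : Fin n → ℝ,
            IsLeadingLeftEigenvector
              (transMatrix (fun k => G k ω) (fun k i j l => Y k i j l ω) δ t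
                (3 * n * pUnion p δ t)) πhat ∧
            relErr πhat (piStar w t) ≤
              1536 * (M * δ * n * maxRatio w t ^ (7 / 2 : ℝ) / T) +
              64 * C₂ * maxRatio w t ^ (9 / 2 : ℝ) *
                √(3 / (L * n * pUnion p δ t * pSum p δ t))} := by
  -- `c₁ = 10` gives `exp (-n) ≤ n ^ (-10)`. `c₂ = 40` makes the exponent `7 / 20 * 40 = 14`, enough
  -- for the union over `n ^ 2` pairs. `K = 5` adds `1` for the graphs and `4` for the noise.
  refine ⟨1, 10, 40, 15, 1, 5, le_rfl, by norm_num, by norm_num, le_rfl, le_rfl, by norm_num, ?_⟩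
  intro Ω _ μ _ n T L w M p G Y t δ hn hT hL hw hM hLip hdata ht hδ hlog _ hS hsmall
  -- For `n = 1` the claimed lower bound is `1 - 5 < 0`.
  rcases hn.eq_or_lt with rfl | hn2
  · refine le_trans ?_ measureReal_nonneg
    norm_num
  have hn' : (2 : ℝ) ≤ n := by exact_mod_cast hn2
  have hn0 : (0 : ℝ) < n := by linarith
  have hlog2 : 1 / 2 ≤ Real.log n := by
    have h := Real.log_le_log (by norm_num) hn'
    linarith [Real.log_two_gt_d9]
  have hδ0 : 0 ≤ δ := le_trans (by norm_num) hδ.1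
  set d := 3 * n * pUnion p δ t
  set ε := 1536 * (M * δ * n * maxRatio w t ^ (7 / 2 : ℝ) / T) +
    64 * 1 * maxRatio w t ^ (9 / 2 : ℝ) * √(3 / (L * n * pUnion p δ t * pSum p δ t))
  change _ ≤ μ.real {ω | EstimatorWithin w (fun k => G k ω) (fun k i j l => Y k i j l ω) δ t d ε}
  set V : Ω → Fin (T + 1) × {e : Fin n × Fin n // e.1 < e.2} × Fin L → Bool :=
    fun ω x => Y x.1 x.2.1.1.1 x.2.1.1.2 x.2.2 ω
  -- Independence from the graphs is given only for the outcomes with `i < j`, so the event is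
  -- rewritten as a function of those. They range over a finite discrete space, where every set is
  -- measurable.
  have hext : ∀ (g : Fin (T + 1) → SimpleGraph (Fin n)) (ω : Ω),
      EstimatorWithin w g (extendOutcome (V ω)) δ t d ε ↔
        EstimatorWithin w g (fun k i j l => Y k i j l ω) δ t d ε := fun g ω => by
    have h := transMatrix_congr (g := g) (δ := δ) (t := t) (d := d)
      (y := extendOutcome (V ω)) (y' := fun k i j l => Y k i j l ω) fun k i j l hij =>
        extendOutcome_eq (y := fun k i j l => Y k i j l ω)
          (fun k i j l hij => hdata.swap_outcome k i j l ω hij) l hij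
    rw [EstimatorWithin, h, EstimatorWithin]
  have hgraph := measureReal_card_nbhdPair_le hdata.measurable_graph hdata.law_graph
    hdata.indep_graph δ t
  have hcond := measureReal_le_of_indepFun (μ := μ) (U := fun ω k => G k ω) (V := V)
    (measurable_pi_lambda _ hdata.measurable_graph) hdata.indep_graph_outcome
    (good := {g | ∀ i j, i ≠ j → pSum p δ t / 4 ≤ (nbhdPair g δ t i j).card})
    (S := fun g => {z | ¬EstimatorWithin w g (extendOutcome z) δ t d ε})
    (fun g => MeasurableSet.of_discrete) (ε := 4 / (n : ℝ) ^ 10) (by positivity)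
    (fun g hg => by
      refine le_trans (measureReal_mono ?_) (measureReal_not_estimatorWithin_le hn2 hT hL hw hM
        hLip hdata ht hδ0 hlog (by linarith) hsmall hg)
      intro ω hω
      exact fun h => hω ((hext g ω).2 h))
  have hgraph' : (n : ℝ) ^ 2 * Real.exp (-(7 / 20 * pSum p δ t)) ≤ 1 / (n : ℝ) ^ 10 := by
    have h1 : Real.exp (-(7 / 20 * pSum p δ t)) ≤ ((n : ℝ) ^ 14)⁻¹ := by
      rw [← Real.exp_log (by positivity : (0 : ℝ) < (n : ℝ) ^ 14), ← Real.exp_neg, Real.log_pow]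
      refine Real.exp_le_exp.2 ?_
      push_cast
      linarith
    calc _ ≤ (n : ℝ) ^ 2 * ((n : ℝ) ^ 14)⁻¹ := by gcongr
      _ = 1 / (n : ℝ) ^ 12 := by field_simp
      _ ≤ 1 / (n : ℝ) ^ 10 := by
        gcongr
        · linarith
        · norm_num
  -- Covering the whole space and using subadditivity avoids complements, so the measurability of
  -- the success event in `Ω` is never needed.
  have hcover : (Set.univ : Set Ω) ⊆
      {ω | EstimatorWithin w (fun k => G k ω) (fun k i j l => Y k i j l ω) δ t d ε} ∪
      ({ω | ∃ i j, i ≠ j ∧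
        ((nbhdPair (fun k => G k ω) δ t i j).card : ℝ) ≤ pSum p δ t / 4} ∪
      {ω | (fun k => G k ω) ∈
          {g | ∀ i j, i ≠ j → pSum p δ t / 4 ≤ ((nbhdPair g δ t i j).card : ℝ)} ∧
        V ω ∈ {z | ¬EstimatorWithin w (fun k => G k ω) (extendOutcome z) δ t d ε}}) := by
    intro ω _
    by_contra hcon
    simp only [Set.mem_union, Set.mem_ofPred_eq, not_or, not_exists, not_and, not_le, not_not]
      at hcon
    exact hcon.1 ((hext _ ω).1 (hcon.2.2 fun i j hij => (hcon.2.1 i j hij).le))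
  have htotal := (measureReal_mono (μ := μ) hcover).trans ((measureReal_union_le _ _).trans
    (add_le_add_right (measureReal_union_le _ _) _))
  rw [probReal_univ] at htotal
  have hK : 5 / (n : ℝ) ^ 10 = 1 / (n : ℝ) ^ 10 + 4 / (n : ℝ) ^ 10 := by ring
  rw [hK]
  linarith
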